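/- Let $F_2$ be the free group on $t_1,t_2$, let $[x,y]=x^{-1}y^{-1}xy$, and for $x\in F_2$ let $\varphi_x$ be the inner automorphism $y\mapsto xyx^{-1}$; let $\mathrm{Int}(F_2)=\{\varphi_x : x\in F_2\}$. Identify the abelianization of $F_2$ with $\mathbb Z^2$. Every endomorphism of $F_2$ induces an endomorphism of $\mathbb Z^2$, and is called direct if the latter has positive determinant; let $\rho:\mathrm{Aut}(F_2)\to GL(2,\mathbb Z)$ be the induced homomorphism and $\mathrm{Aut}^+(F_2)=\rho^{-1}(SL(2,\mathbb Z))$ the group of direct automorphisms. Let $B_3=\langle a,b\mid aba=bab\rangle$, $s=aba$, $Y=\langle s^4\rangle$, and let $\Psi:B_3\to\mathrm{Aut}(F_2)$ be the homomorphism with $$\Psi(a):(t_1,t_2)\mapsto(t_1,t_1^{-1}t_2),\qquad \Psi(b):(t_1,t_2)\mapsto(t_2t_1,t_2).$$ Let $\psi:B_3\to\mathrm{Aut}(\mathrm{Int}(F_2))$ be $\psi(c)(h)=\Psi(c)\circ h\circ\Psi(c)^{-1}$. The homomorphism $\Psi$ maps $Y$ injectively into $\mathrm{Int}(F_2)$,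 with $s^4\mapsto\varphi_{[t_1,t_2]}$, and the semidirect product amalgamated over $Y$, denoted $\mathrm{Int}(F_2)\rtimes_{\psi,Y}B_3$, is the quotient of $\mathrm{Int}(F_2)\rtimes_\psi B_3$ by the normal subgroup $\{(\Psi(y)^{-1},y): y\in Y\}$. **Theorem.** (i) Every surjective endomorphism of $F_2$ is an automorphism. (ii) The homomorphism $\Psi$ is injective (so that $B_3$ is identified with $\Psi(B_3)$) and $\Psi(s^4)=\varphi_{[t_1,t_2]}$. The center of $B_3$ is $\langle s^2\rangle$, and $Y$ is a subgroup of index $2$ of it. One has $\mathrm{Int}(F_2)\cap\Psi(B_3)=\Psi(Y)=\langle\varphi_{[t_1,t_2]}\rangle$ and $\mathrm{Aut}^+(F_2)=\mathrm{Int}(F_2)\,\Psi(B_3)$, and the map $(h,c)\mapsto h\,\Psi(c)$ induces an isomorphism $$\mathrm{Int}(F_2)\rtimes_{\psi,Y}B_3\;\cong\;\mathrm{Aut}^+(F_2).$$ (iii) $\mathrm{Int}(F_2)$ is the kernel of $\rho:\mathrm{Aut}(F_2)\to GL(2,\mathbb Z)$. (iv) An endomorphism $\varphi$ of $F_2$,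 $\varphi(t_i)=X_i$, is a direct automorphism if and only if $[X_1,X_2]=w^{-1}[t_1,t_2]w$ for some $w\in F_2$. Moreover it lies in $\Psi(B_3)$ if and only if $[X_1,X_2]=[t_1,t_2]$. -/

import Mathlib

namespace Nielsen

/-! ### Semidirect products amalgamated over a common subgroup -/

section Amalgam

variable {K L M : Type*} [Group K] [Group L] [Group M]

/-- The conditions on `ψ : L → Aut K`, `κ : M → K`, `lam : M → L` under which `M` can be viewed as
a common subgroup of `K` and `L` over which the semidirect product `K ⋊[ψ] L` is amalgamated. -/
structure AmalgamConditions (ψ : L →* MulAut K) (κ : M →* K) (lam : M →* L) : Prop where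
  κ_injective : Function.Injective κ
  lam_injective : Function.Injective lam
  lam_normal : lam.range.Normal
  /-- `ψ l` maps `κ M` to itself, acting there as conjugation by `l` acts on `lam M`. -/
  compat : ∀ (l : L) (m m' : M), lam m' = l * lam m * l⁻¹ → ψ l (κ m) = κ m'
  /-- the elements of `M` act on `K` by inner automorphisms. -/
  inner : ∀ (m : M) (k : K), ψ (lam m) k = κ m * k * (κ m)⁻¹

variable {ψ : L →* MulAut K} {κ : M →* K} {lam : M →* L}

/-- The homomorphism `m ↦ (m⁻¹, m)` from `M` to `K ⋊[ψ] L`. -/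
def antidiag (h : AmalgamConditions ψ κ lam) : M →* K ⋊[ψ] L where
  toFun m := ⟨(κ m)⁻¹, lam m⟩
  map_one' := by ext <;> simp
  map_mul' m m' := by
    ext
    · simp [h.inner, mul_assoc]
    · simp

instance antidiag_range_normal (h : AmalgamConditions ψ κ lam) : (antidiag h).range.Normal := by
  constructor
  rintro _ ⟨m, rfl⟩ ⟨k, l⟩
  obtain ⟨m', hm'⟩ := h.lam_normal.conj_mem (lam m) ⟨m, rfl⟩ l
  refine ⟨m', ?_⟩
  have hc := h.compat l m m' hm'
  ext
  · have h1 : ψ (l * lam m * l⁻¹) k⁻¹ = κ m' * k⁻¹ * (κ m')⁻¹ := by rw [← hm', h.inner]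
    simp only [map_mul, MulAut.mul_apply] at h1
    simp only [antidiag, MonoidHom.coe_mk, OneHom.coe_mk, SemidirectProduct.mul_left,
      SemidirectProduct.mul_right, SemidirectProduct.inv_left, map_inv, hc, map_mul,
      MulAut.mul_apply] at h1 ⊢
    rw [h1]
    group
  · simp [antidiag, hm']

/-- The semidirect product of `K` and `L` along `ψ`, amalgamated over `M`. -/
abbrev AmalgamatedSemidirectProduct (h : AmalgamConditions ψ κ lam) : Type _ :=
  (K ⋊[ψ] L) ⧸ (antidiag h).range

end Amalgam

/-! ### The free group of rank two, its automorphisms and its abelianization -/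

/-- The free group of rank two. -/
abbrev F2 : Type := FreeGroup (Fin 2)

/-- The first generator. -/
abbrev t₁ : F2 := FreeGroup.of 0

/-- The second generator. -/
abbrev t₂ : F2 := FreeGroup.of 1

/-- The commutator with the convention `[x, y] = x⁻¹ y⁻¹ x y`. -/
def comm {G : Type*} [Group G] (x y : G) : G := x⁻¹ * y⁻¹ * x * y

/-- The group of inner automorphisms `y ↦ x * y * x⁻¹` of `F2`. -/
abbrev IntF2 : Subgroup (MulAut F2) := (MulAut.conj : F2 →* MulAut F2).range

instance IntF2_normal : IntF2.Normal := by
  constructor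
  rintro _ ⟨x, rfl⟩ g
  refine ⟨g x, ?_⟩
  ext y
  simp [MulAut.conj_apply]

/-- The abelianization map `F2 → ℤ²`, recording the exponent sums of the two generators. -/
def ab : F2 →* Multiplicative (Fin 2 → ℤ) :=
  FreeGroup.lift fun i => Multiplicative.ofAdd (Pi.single i 1)

/-- The matrix of the endomorphism of `ℤ²` induced by an endomorphism `x` of `F2`: its `j`-th
column is the image in `ℤ²` of `x tⱼ`. -/
def abMatrix (x : F2 →* F2) : Matrix (Fin 2) (Fin 2) ℤ :=
  Matrix.of fun i j => (ab (x (FreeGroup.of j))).toAdd i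

theorem ab_surjective : Function.Surjective ab := by
  intro v
  refine ⟨t₁ ^ (v.toAdd 0) * t₂ ^ (v.toAdd 1), ?_⟩
  apply Multiplicative.toAdd.injective
  ext i
  fin_cases i <;> simp [ab]

/-- `ab` is the abelianization of `F2`. -/
theorem ab_ker : ab.ker = commutator F2 := by
  apply le_antisymm
  · intro x hx
    let g : Multiplicative (Fin 2 → ℤ) →* Abelianization F2 :=
      { toFun := fun v => Abelianization.of t₁ ^ (v.toAdd 0) * Abelianization.of t₂ ^ (v.toAdd 1)
        map_one' := by simp
        map_mul' := fun v w => by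
          simp only [toAdd_mul, Pi.add_apply, zpow_add]
          exact mul_mul_mul_comm _ _ _ _ }
    have hg : g.comp ab = Abelianization.of := by
      ext i
      fin_cases i <;> simp [g, ab]
    have h1 : Abelianization.of x = 1 := by
      rw [← hg, MonoidHom.comp_apply, (MonoidHom.mem_ker).1 hx, map_one]
    exact (QuotientGroup.eq_one_iff x).1 h1
  · exact Abelianization.commutator_subset_ker ab

/-- The endomorphism of `ℤ²` with matrix `abMatrix x` is the one induced by `x`. -/
theorem ab_apply (x : F2 →* F2) (y : F2) :
    (ab (x y)).toAdd = (abMatrix x).mulVec (ab y).toAdd := by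
  let f : Multiplicative (Fin 2 → ℤ) →* Multiplicative (Fin 2 → ℤ) :=
    AddMonoidHom.toMultiplicative (Matrix.mulVecLin (abMatrix x)).toAddMonoidHom
  have h : ab.comp x = f.comp ab := by
    ext j i
    simp [f, ab, abMatrix]
  exact congrArg Multiplicative.toAdd (DFunLike.congr_fun h y)

theorem abMatrix_id : abMatrix (MonoidHom.id F2) = 1 := by
  ext i j
  simp [abMatrix, ab, Matrix.one_apply, Pi.single_apply]

theorem abMatrix_comp (x y : F2 →* F2) : abMatrix (x.comp y) = abMatrix x * abMatrix y := by
  ext i j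
  have h := congrFun (ab_apply x (y (FreeGroup.of j))) i
  simpa [abMatrix, Matrix.mul_apply, Matrix.mulVec, dotProduct] using h

/-- The homomorphism `Aut F2 → GL(2, ℤ)` induced by the abelianization `F2 → ℤ²`. -/
def ρ : MulAut F2 →* Matrix.GeneralLinearGroup (Fin 2) ℤ :=
  MonoidHom.toHomUnits
    { toFun := fun x => abMatrix x.toMonoidHom
      map_one' := abMatrix_id
      map_mul' := fun x y => abMatrix_comp x.toMonoidHom y.toMonoidHom }

/-- The group of direct automorphisms of `F2`: the preimage of `SL(2, ℤ)` by `ρ`. -/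
def AutPlus : Subgroup (MulAut F2) :=
  (Matrix.SpecialLinearGroup.toGL : Matrix.SpecialLinearGroup (Fin 2) ℤ →*
    Matrix.GeneralLinearGroup (Fin 2) ℤ).range.comap ρ

/-- An endomorphism of `F2` is direct if the endomorphism it induces on `ℤ²` has positive
determinant. -/
def IsDirect (x : F2 →* F2) : Prop := 0 < (abMatrix x).det

/-- The direct automorphisms are the automorphisms that are direct as endomorphisms. -/
theorem mem_AutPlus_iff (x : MulAut F2) : x ∈ AutPlus ↔ IsDirect x.toMonoidHom := by
  have hρ : ((ρ x : Matrix.GeneralLinearGroup (Fin 2) ℤ) : Matrix (Fin 2) (Fin 2) ℤ)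
      = abMatrix x.toMonoidHom := rfl
  constructor
  · rintro ⟨g, hg⟩
    have h1 : (g : Matrix (Fin 2) (Fin 2) ℤ) = abMatrix x.toMonoidHom := by
      rw [← hρ, ← hg]; rfl
    unfold IsDirect
    rw [← h1, g.det_coe]
    exact one_pos
  · intro h
    have hu : IsUnit (abMatrix x.toMonoidHom).det := by
      rw [← hρ, ← Matrix.isUnit_iff_isUnit_det]
      exact (ρ x).isUnit
    have h1 : (abMatrix x.toMonoidHom).det = 1 := by
      rcases Int.isUnit_iff.1 hu with h2 | h2
      · exact h2
      · unfold IsDirect at h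
        omega
    exact ⟨⟨abMatrix x.toMonoidHom, h1⟩, Units.ext rfl⟩

/-! ### The braid group on three strands and its action on `F2` -/

/-- The relator `a b a (b a b)⁻¹`. -/
def braidRelations : Set (FreeGroup (Fin 2)) :=
  {FreeGroup.of 0 * FreeGroup.of 1 * FreeGroup.of 0 *
    (FreeGroup.of 1 * FreeGroup.of 0 * FreeGroup.of 1)⁻¹}

/-- Artin's braid group on three strands, `⟨a, b | a b a = b a b⟩`. -/
abbrev B3 : Type := PresentedGroup braidRelations

namespace B3

/-- The first standard generator. -/
def a : B3 := PresentedGroup.of 0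

/-- The second standard generator. -/
def b : B3 := PresentedGroup.of 1

/-- The element `s = a b a = b a b`. -/
def s : B3 := a * b * a

theorem braid : a * b * a = b * a * b := by
  have h : (PresentedGroup.mk braidRelations (FreeGroup.of 0 * FreeGroup.of 1 * FreeGroup.of 0 *
      (FreeGroup.of 1 * FreeGroup.of 0 * FreeGroup.of 1)⁻¹) : B3) = 1 :=
    PresentedGroup.one_of_mem rfl
  rw [map_mul, map_inv, mul_inv_eq_one] at h
  simp only [map_mul] at h
  exact h

theorem s_mul_a : s * a = b * s := by
  have h := braid
  unfold s
  calc a * b * a * a = b * a * b * a := by rw [h]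
    _ = b * (a * b * a) := by group

theorem s_mul_b : s * b = a * s := by
  unfold s
  calc a * b * a * b = a * (b * a * b) := by group
    _ = a * (a * b * a) := by rw [braid]

theorem s_sq_mem_center : s ^ 2 ∈ Subgroup.center B3 := by
  have ha : a ∈ Subgroup.centralizer {s ^ 2} := by
    rw [Subgroup.mem_centralizer_singleton_iff, sq, mul_assoc, s_mul_a, ← mul_assoc s b, s_mul_b, mul_assoc]
  have hb : b ∈ Subgroup.centralizer {s ^ 2} := by
    rw [Subgroup.mem_centralizer_singleton_iff, sq, mul_assoc, s_mul_b, ← mul_assoc s a, s_mul_a, mul_assoc]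
  have htop : (⊤ : Subgroup B3) ≤ Subgroup.centralizer {s ^ 2} := by
    rw [← PresentedGroup.closure_range_of, Subgroup.closure_le]
    rintro _ ⟨i, rfl⟩
    fin_cases i
    · exact ha
    · exact hb
  rw [Subgroup.mem_center_iff]
  intro g
  exact Subgroup.mem_centralizer_singleton_iff.1 (htop (Subgroup.mem_top g))

/-- The subgroup generated by `s⁴`. -/
abbrev Y : Subgroup B3 := Subgroup.zpowers (s ^ 4)

theorem Y_le_center : Y ≤ Subgroup.center B3 := by
  rw [Subgroup.zpowers_le, show s ^ 4 = (s ^ 2) ^ 2 by group]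
  exact Subgroup.pow_mem _ s_sq_mem_center 2

end B3

/-- The automorphism `t₁ ↦ t₁, t₂ ↦ t₁⁻¹ t₂`, with inverse `t₁ ↦ t₁, t₂ ↦ t₁ t₂`. -/
def α : MulAut F2 :=
  MonoidHom.toMulEquiv (FreeGroup.lift ![t₁, t₁⁻¹ * t₂]) (FreeGroup.lift ![t₁, t₁ * t₂])
    (by ext i; fin_cases i <;> simp) (by ext i; fin_cases i <;> simp)

/-- The automorphism `t₁ ↦ t₂ t₁, t₂ ↦ t₂`, with inverse `t₁ ↦ t₂⁻¹ t₁, t₂ ↦ t₂`. -/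
def β : MulAut F2 :=
  MonoidHom.toMulEquiv (FreeGroup.lift ![t₂ * t₁, t₂]) (FreeGroup.lift ![t₂⁻¹ * t₁, t₂])
    (by ext i; fin_cases i <;> simp) (by ext i; fin_cases i <;> simp)

@[simp] theorem α_t₁ : α t₁ = t₁ := by simp [α]
@[simp] theorem α_t₂ : α t₂ = t₁⁻¹ * t₂ := by simp [α]
@[simp] theorem β_t₁ : β t₁ = t₂ * t₁ := by simp [β]
@[simp] theorem β_t₂ : β t₂ = t₂ := by simp [β]

theorem mulAut_F2_ext {x y : MulAut F2} (h₁ : x t₁ = y t₁) (h₂ : x t₂ = y t₂) : x = y := by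
  have h : x.toMonoidHom = y.toMonoidHom := by
    ext i
    fin_cases i
    · exact h₁
    · exact h₂
  ext z
  exact DFunLike.congr_fun h z

theorem αβα : α * β * α = β * α * β := by
  apply mulAut_F2_ext <;> simp [MulAut.mul_apply, mul_assoc]

/-- The homomorphism `B3 → Aut F2` with `a ↦ α`, `b ↦ β`. -/
def Ψ : B3 →* MulAut F2 :=
  PresentedGroup.toGroup (f := ![α, β]) (by
    rintro _ rfl
    simp only [map_mul, map_inv, FreeGroup.lift_apply_of]
    exact mul_inv_eq_one.2 αβα)

theorem Ψ_a : Ψ B3.a = α := by simp [B3.a, Ψ]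

theorem Ψ_b : Ψ B3.b = β := by simp [B3.b, Ψ]

theorem Ψ_s_pow_four : Ψ (B3.s ^ 4) = MulAut.conj (comm t₁ t₂) := by
  have hs : Ψ B3.s = α * β * α := by rw [B3.s, map_mul, map_mul, Ψ_a, Ψ_b]
  have h1 : (α * β * α) t₁ = t₁⁻¹ * t₂ * t₁ := by simp [MulAut.mul_apply]
  have h2 : (α * β * α) t₂ = t₁⁻¹ := by simp [MulAut.mul_apply]
  rw [map_pow, hs]
  generalize α * β * α = σ at h1 h2
  apply mulAut_F2_ext <;>
    simp [pow_succ, MulAut.mul_apply, h1, h2, MulAut.conj_apply, comm, mul_assoc]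

theorem conj_comm_zpow_eq_one {n : ℤ}
    (h : (MulAut.conj (comm t₁ t₂) : MulAut F2) ^ n = 1) : n = 0 := by
  by_contra hn
  rw [← map_zpow] at h
  have h1 : comm t₁ t₂ ^ n * t₁ * (comm t₁ t₂ ^ n)⁻¹ = t₁ := by
    rw [← MulAut.conj_apply, h, MulAut.one_apply]
  have h2 : (t₁ * comm t₁ t₂ * t₁⁻¹) ^ n = comm t₁ t₂ ^ n := by
    rw [conj_zpow]
    nth_rewrite 1 [← h1]
    group
  have h3 := zpow_left_injective hn h2
  revert h3
  unfold comm t₁ t₂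
  decide

/-- The action `x ↦ (h ↦ x ∘ h ∘ x⁻¹)` of `B3`, mapped to `Aut F2` by `Ψ`, on `Int F2`. -/
def ψ : B3 →* MulAut IntF2 := MulAut.conjNormal.comp Ψ

/-- The homomorphism `⟨s⁴⟩ → Int F2` that maps `s⁴` to the inner automorphism by `[t₁, t₂]`. -/
def κ : B3.Y →* IntF2 :=
  (Ψ.comp B3.Y.subtype).codRestrict IntF2 (by
    rintro ⟨_, n, rfl⟩
    refine ⟨comm t₁ t₂ ^ n, ?_⟩
    simp only [MonoidHom.comp_apply, Subgroup.subtype_apply, map_zpow, Ψ_s_pow_four])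

theorem amalgamConditions : AmalgamConditions ψ κ B3.Y.subtype where
  κ_injective := by
    rw [injective_iff_map_eq_one]
    rintro ⟨_, n, rfl⟩ h
    have h1 : Ψ ((B3.s ^ 4) ^ n) = 1 := congrArg Subtype.val h
    rw [map_zpow, Ψ_s_pow_four] at h1
    apply Subtype.ext
    simp [conj_comm_zpow_eq_one h1]
  lam_injective := Subtype.val_injective
  lam_normal := by
    rw [Subgroup.range_subtype]
    constructor
    intro n hn g
    rw [Subgroup.mem_center_iff.1 (B3.Y_le_center hn) g, mul_inv_cancel_right]
    exact hn
  compat := by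
    intro l m m' h
    apply Subtype.ext
    have h1 : Ψ (m' : B3) = Ψ l * Ψ (m : B3) * (Ψ l)⁻¹ := by
      rw [← map_inv, ← map_mul, ← map_mul]; exact congrArg Ψ h
    exact h1.symm
  inner := by
    intro m k
    apply Subtype.ext
    rfl

end Nielsen

/-! Embed the free group in SL(2, ℤ) by `θ`, with images `A`, `B` such that `A`, `B`, `B * A` have
trace 3 and the commutator of `A`, `B` has trace -2. By Fricke's identity `tr_comm`, an endomorphism
φ for which `θ` sends [φ t₁, φ t₂] to trace -2 yields a solution of x² + y² + z² = xyz, the traces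
of the images of t₁, t₂, t₂t₁. Braids fix [t₁, t₂] and act on the solutions by Markov moves, so
descent (`markov_step`, `exists_act_isReduced`) reaches (±3, ±3, ±3). Signs do no harm, because `θ
v` is never `-θ w`. A pair with traces (3, 3, 3) is conjugate to (A, B) or (B, A) by
`exists_conj_of_traces`, and conjugation by SL(2, ℤ) restricts to the image of `θ` as a product of
inner automorphisms and braids (`exists_conj_θ`). So φ is such a product, up to exchanging the
generators (`exists_eq_of_tr_comm`); the determinant detects the exchange. If [t₁, t₂] itself is
preserved, the conjugating matrix is a power of `T`, which acts as a braid.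

A surjective φ does give trace -2: det(gh - hg) = 2 - tr [g, h], and `two_sub_tr_comm_dvd`, used for
φ and for preimages of the generators, leaves only the traces -2 and 6. Modulo 3 the image of `θ`
lies in a quaternion group, which excludes 6.

On the braid side, a normal form in `a`, `b⁻¹` and `s` shows that the kernel of the action of `B3`
on ℤ² is exactly `Y` (`ker_η`), on which `Ψ` is injective with inner values. Injectivity of `Ψ`, the
intersection, the kernel of `ρ` and the amalgamated product follow. -/

namespace Nielsen

open Matrix

/-! ### Traces in `SL(2, ℤ)` -/

/-- The group `SL(2, ℤ)`. -/
abbrev SL2Z : Type := Matrix.SpecialLinearGroup (Fin 2) ℤ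

/-- The trace of an element of `SL(2, ℤ)`. -/
def tr (g : SL2Z) : ℤ := g 0 0 + g 1 1

theorem SL2Z_det (g : SL2Z) : g 0 0 * g 1 1 - g 0 1 * g 1 0 = 1 := by
  rw [← Matrix.det_fin_two, g.det_coe]

theorem SL2Z_ext {g h : SL2Z} (h₀₀ : g 0 0 = h 0 0) (h₀₁ : g 0 1 = h 0 1) (h₁₀ : g 1 0 = h 1 0)
    (h₁₁ : g 1 1 = h 1 1) : g = h := by
  ext i j
  fin_cases i <;> fin_cases j <;> assumption

theorem SL2Z_mul_apply (g h : SL2Z) (i j : Fin 2) :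
    (g * h) i j = g i 0 * h 0 j + g i 1 * h 1 j := by
  simp [Matrix.mul_apply]

@[simp] theorem SL2Z_inv_zero_zero (g : SL2Z) : g⁻¹ 0 0 = g 1 1 := by
  simp [Matrix.SpecialLinearGroup.coe_inv, Matrix.adjugate_fin_two]

@[simp] theorem SL2Z_inv_zero_one (g : SL2Z) : g⁻¹ 0 1 = -g 0 1 := by
  simp [Matrix.SpecialLinearGroup.coe_inv, Matrix.adjugate_fin_two]

@[simp] theorem SL2Z_inv_one_zero (g : SL2Z) : g⁻¹ 1 0 = -g 1 0 := by
  simp [Matrix.SpecialLinearGroup.coe_inv, Matrix.adjugate_fin_two]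

@[simp] theorem SL2Z_inv_one_one (g : SL2Z) : g⁻¹ 1 1 = g 0 0 := by
  simp [Matrix.SpecialLinearGroup.coe_inv, Matrix.adjugate_fin_two]

theorem tr_mul_comm (g h : SL2Z) : tr (g * h) = tr (h * g) := by
  simp only [tr, SL2Z_mul_apply]
  ring

@[simp] theorem tr_inv (g : SL2Z) : tr g⁻¹ = tr g := by
  simp [tr, add_comm]

@[simp] theorem tr_one : tr 1 = 2 := by
  simp [tr]

theorem tr_neg (g : SL2Z) : tr (-g) = -tr g := by
  simp [tr]
  ring

theorem tr_conj (g h : SL2Z) : tr (g * h * g⁻¹) = tr h := by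
  rw [tr_mul_comm, inv_mul_cancel_left]

/-- Cayley–Hamilton, g + g⁻¹ = tr g, multiplied by h. -/
theorem tr_inv_mul (g h : SL2Z) : tr (g⁻¹ * h) = tr g * tr h - tr (g * h) := by
  simp only [tr, SL2Z_mul_apply, SL2Z_inv_zero_zero, SL2Z_inv_zero_one, SL2Z_inv_one_zero,
    SL2Z_inv_one_one]
  ring

theorem tr_mul_mul (g h : SL2Z) : tr (g * (g * h)) = tr g * tr (g * h) - tr h := by
  have := tr_inv_mul g (g * h)
  rw [inv_mul_cancel_left] at this
  linarith

/-- The Fricke identity. -/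
theorem tr_comm (g h : SL2Z) :
    tr (comm g h) = tr g ^ 2 + tr h ^ 2 + tr (h * g) ^ 2 - tr g * tr h * tr (h * g) - 2 := by
  have h₁ : tr (comm g h) = tr g * tr (h⁻¹ * g * h) - tr (g * (h⁻¹ * g * h)) := by
    rw [← tr_inv_mul, comm]
    simp only [mul_assoc]
  have h₂ : tr (h⁻¹ * g * h) = tr g := by simpa using tr_conj h⁻¹ g
  have h₃ : tr (g * (h⁻¹ * g * h)) = tr (h⁻¹ * (g * (h * g))) := by
    rw [tr_mul_comm]
    simp only [mul_assoc]
  have h₄ : tr (g * (h * g)) = tr g * tr (h * g) - tr h := by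
    rw [tr_mul_comm, mul_assoc, tr_mul_comm h, mul_assoc, tr_mul_mul, tr_mul_comm]
  have h₅ : tr (h * (g * (h * g))) = tr (h * g) ^ 2 - 2 := by
    have := tr_mul_mul (h * g) 1
    simp only [mul_one, tr_one, ← sq] at this
    rw [← this, sq]
    simp only [mul_assoc]
  rw [h₁, h₂, h₃, tr_inv_mul, h₄, h₅]
  ring

theorem comm_neg_left (g h : SL2Z) : comm (-g) h = comm g h := by
  simp [comm, inv_neg]

theorem comm_neg_right (g h : SL2Z) : comm g (-h) = comm g h := by
  simp [comm, inv_neg]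

theorem map_comm {G H : Type*} [Group G] [Group H] (f : G →* H) (x y : G) :
    f (comm x y) = comm (f x) (f y) := by
  simp [comm]

/-! ### The discriminant of a pair of matrices -/

/-- The additive commutator of two elements of `SL(2, ℤ)`. -/
def bracket (g h : SL2Z) : Matrix (Fin 2) (Fin 2) ℤ :=
  (g : Matrix (Fin 2) (Fin 2) ℤ) * h - h * g

/-- Since gh - hg = hg([g, h] - 1), the determinant is that of K - 1 with det K = 1, which is 2 - tr
K. -/
theorem det_bracket (g h : SL2Z) : (bracket g h).det = 2 - tr (comm g h) := by
  have h₁ : bracket g h = ((h * g : SL2Z) : Matrix (Fin 2) (Fin 2) ℤ) *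
      ((comm g h : SL2Z) - (1 : Matrix (Fin 2) (Fin 2) ℤ)) := by
    rw [mul_sub, mul_one, ← Matrix.SpecialLinearGroup.coe_mul, bracket, ← Matrix.SpecialLinearGroup.coe_mul,
      ← Matrix.SpecialLinearGroup.coe_mul]
    rw [show h * g * comm g h = g * h by simp [comm, mul_assoc]]
  rw [h₁, det_mul, Matrix.SpecialLinearGroup.det_coe, one_mul, det_fin_two]
  have := SL2Z_det (comm g h)
  simp [tr]
  linarith

/-- Substituting g⁻¹ = tr g - g makes both sides equal to ghg - (tr g) hg + h. -/
theorem bracket_mul_left (g h : SL2Z) :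
    bracket g h * (g : Matrix (Fin 2) (Fin 2) ℤ) = (g⁻¹ : SL2Z) * bracket g h := by
  ext i j
  fin_cases i <;> fin_cases j <;>
  simp [bracket, Matrix.mul_apply, Matrix.SpecialLinearGroup.coe_inv, adjugate_fin_two] <;> ring

theorem bracket_swap (g h : SL2Z) : bracket h g = -bracket g h := by
  simp [bracket]

theorem bracket_mul_right (g h : SL2Z) :
    bracket g h * (h : Matrix (Fin 2) (Fin 2) ℤ) = (h⁻¹ : SL2Z) * bracket g h := by
  have := bracket_mul_left h g
  rwa [bracket_swap, neg_mul, mul_neg, neg_inj] at this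

theorem bracket_mul_inv {g h k : SL2Z}
    (hk : bracket g h * (k : Matrix (Fin 2) (Fin 2) ℤ) = (k⁻¹ : SL2Z) * bracket g h) :
    bracket g h * ((k⁻¹ : SL2Z) : Matrix (Fin 2) (Fin 2) ℤ) = k * bracket g h := by
  calc bracket g h * ((k⁻¹ : SL2Z) : Matrix (Fin 2) (Fin 2) ℤ)
      = (k * k⁻¹ : SL2Z) * bracket g h * ((k⁻¹ : SL2Z) : Matrix (Fin 2) (Fin 2) ℤ) := by simp
    _ = k * ((k⁻¹ : SL2Z) * bracket g h) * ((k⁻¹ : SL2Z) : Matrix (Fin 2) (Fin 2) ℤ) := by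
        rw [Matrix.SpecialLinearGroup.coe_mul]; simp only [mul_assoc]
    _ = k * bracket g h * ((k * k⁻¹ : SL2Z) : Matrix (Fin 2) (Fin 2) ℤ) := by
        rw [← hk, Matrix.SpecialLinearGroup.coe_mul]; simp only [mul_assoc]
    _ = k * bracket g h := by simp

/-- Moving a generator across the bracket inverts it. Hence the left multiples of the bracket are
stable under right multiplication by the image of `f`. -/
theorem exists_bracket_mul_eq (f : F2 →* SL2Z) (w : F2) :
    ∃ N : Matrix (Fin 2) (Fin 2) ℤ,
      bracket (f t₁) (f t₂) * (f w : Matrix (Fin 2) (Fin 2) ℤ) = N * bracket (f t₁) (f t₂) := by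
  have hof : ∀ i : Fin 2, bracket (f t₁) (f t₂) * (f (FreeGroup.of i) : Matrix (Fin 2) (Fin 2) ℤ)
      = ((f (FreeGroup.of i))⁻¹ : SL2Z) * bracket (f t₁) (f t₂) := by
    intro i
    fin_cases i
    · exact bracket_mul_left _ _
    · exact bracket_mul_right _ _
  induction w using FreeGroup.induction_on with
  | C1 => exact ⟨1, by simp⟩
  | of i => exact ⟨_, hof i⟩
  | inv_of i _ => exact ⟨_, by rw [map_inv]; exact bracket_mul_inv (hof i)⟩
  | mul x y hx hy =>
    obtain ⟨M, hM⟩ := hx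
    obtain ⟨N, hN⟩ := hy
    exact ⟨M * N, by rw [map_mul, Matrix.SpecialLinearGroup.coe_mul, ← mul_assoc, hM, mul_assoc, hN,
      mul_assoc]⟩

/-- The elements whose additive commutator with `g` is a left multiple of the one of the generators
contain all elements as soon as they contain the generators. -/
theorem exists_bracket_eq_of_generators (f : F2 →* SL2Z) (g : SL2Z)
    (hg : ∀ i : Fin 2, ∃ N : Matrix (Fin 2) (Fin 2) ℤ,
      bracket g (f (FreeGroup.of i)) = N * bracket (f t₁) (f t₂)) (w : F2) :
    ∃ N : Matrix (Fin 2) (Fin 2) ℤ, bracket g (f w) = N * bracket (f t₁) (f t₂) := by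
  induction w using FreeGroup.induction_on with
  | C1 => exact ⟨0, by simp [bracket]⟩
  | of i => exact hg i
  | inv_of i _ =>
    obtain ⟨N, hN⟩ := hg i
    obtain ⟨M, hM⟩ := exists_bracket_mul_eq f (FreeGroup.of i)⁻¹
    refine ⟨-((f (FreeGroup.of i)⁻¹ : SL2Z) : Matrix (Fin 2) (Fin 2) ℤ) * N * M, ?_⟩
    rw [mul_assoc, ← hM, mul_assoc, ← mul_assoc N, ← hN, map_inv]
    generalize f (FreeGroup.of i) = k
    have h₁ : (k : Matrix (Fin 2) (Fin 2) ℤ) * ((k⁻¹ : SL2Z) : Matrix (Fin 2) (Fin 2) ℤ) = 1 := by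
      rw [← Matrix.SpecialLinearGroup.coe_mul]; simp
    have h₂ : ((k⁻¹ : SL2Z) : Matrix (Fin 2) (Fin 2) ℤ) * k = 1 := by
      rw [← Matrix.SpecialLinearGroup.coe_mul]; simp
    rw [bracket, bracket, sub_mul, mul_assoc, h₁, neg_mul, mul_sub, ← mul_assoc, ← mul_assoc,
      ← mul_assoc, h₂]
    simp
  | mul x y hx hy =>
    obtain ⟨M, hM⟩ := hx
    obtain ⟨N, hN⟩ := hy
    obtain ⟨P, hP⟩ := exists_bracket_mul_eq f y
    refine ⟨M * P + f x * N, ?_⟩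
    rw [add_mul, mul_assoc, mul_assoc, ← hP, ← hN, ← mul_assoc, ← hM]
    simp only [bracket, map_mul, Matrix.SpecialLinearGroup.coe_mul, sub_mul, mul_sub, mul_assoc]
    abel

/-- The bracket is a derivation in each variable, so the passage from generators to words is made
twice, with antisymmetry in between. -/
theorem exists_bracket_eq (f : F2 →* SL2Z) (v w : F2) :
    ∃ N : Matrix (Fin 2) (Fin 2) ℤ, bracket (f v) (f w) = N * bracket (f t₁) (f t₂) := by
  refine exists_bracket_eq_of_generators f (f v) (fun i => ?_) w
  suffices h : ∃ N : Matrix (Fin 2) (Fin 2) ℤ,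
      bracket (f (FreeGroup.of i)) (f v) = N * bracket (f t₁) (f t₂) by
    obtain ⟨N, hN⟩ := h
    exact ⟨-N, by rw [bracket_swap, hN, neg_mul]⟩
  refine exists_bracket_eq_of_generators f _ (fun j => ?_) v
  fin_cases i <;> fin_cases j
  · exact ⟨0, by simp [bracket]⟩
  · exact ⟨1, by simp⟩
  · exact ⟨-1, by rw [neg_one_mul]; exact bracket_swap _ _⟩
  · exact ⟨0, by simp [bracket]⟩

theorem two_sub_tr_comm_dvd (f : F2 →* SL2Z) (v w : F2) :
    2 - tr (comm (f t₁) (f t₂)) ∣ 2 - tr (comm (f v) (f w)) := by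
  obtain ⟨N, hN⟩ := exists_bracket_eq f v w
  rw [← det_bracket, ← det_bracket, hN, det_mul]
  exact dvd_mul_left _ _

/-! ### A faithful representation of `F2` in `SL(2, ℤ)` -/

/-- The image of the first generator. -/
def A : SL2Z := ⟨!![1, 1; 1, 2], by simp [det_fin_two_of]⟩

/-- The image of the second generator. -/
def B : SL2Z := ⟨!![1, -1; -1, 2], by simp [det_fin_two_of]⟩

theorem A_apply (i j : Fin 2) : A i j = !![1, 1; 1, 2] i j := rfl

theorem B_apply (i j : Fin 2) : B i j = !![1, -1; -1, 2] i j := rfl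

/-- The homomorphism `F2 → SL(2, ℤ)` uniformizing the modular once-punctured torus. -/
def θ : F2 →* SL2Z := FreeGroup.lift ![A, B]

@[simp] theorem θ_t₁ : θ t₁ = A := by simp [θ]

@[simp] theorem θ_t₂ : θ t₂ = B := by simp [θ]

/-- The attracting intervals of the generators, in terms of the first columns of matrices. -/
def attracting : Fin 2 → Set SL2Z :=
  ![{g | (0 ≤ g 0 0 ∧ g 0 0 < g 1 0) ∨ (g 1 0 < g 0 0 ∧ g 0 0 ≤ 0)},
    {g | (-g 1 0 ≤ g 0 0 ∧ g 0 0 < 0) ∨ (0 < g 0 0 ∧ g 0 0 ≤ -g 1 0)}]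

/-- The repelling intervals of the generators, in terms of the first columns of matrices. -/
def repelling : Fin 2 → Set SL2Z :=
  ![{g | g 1 0 = 0 ∨ (g 0 0 < -g 1 0 ∧ 0 < g 1 0) ∨ (-g 1 0 < g 0 0 ∧ g 1 0 < 0)},
    {g | (g 1 0 ≤ g 0 0 ∧ 0 < g 1 0) ∨ (g 0 0 ≤ g 1 0 ∧ g 1 0 < 0)}]

theorem column_ne_zero (g : SL2Z) : ¬(g 0 0 = 0 ∧ g 1 0 = 0) := by
  rintro ⟨h₁, h₂⟩
  have := SL2Z_det g
  rw [h₁, h₂] at this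
  simp at this

/-- Ping-pong on the slopes p/q of first columns (p, q). The intervals [0, 1), [-1, 0) attract and
[∞, -1), [1, ∞) repel; they are half-open because they share endpoints. -/
theorem θ_injective : Function.Injective θ := by
  refine FreeGroup.injective_lift_of_ping_pong (α := SL2Z) ![A, B] attracting repelling
    ?_ ?_ ?_ ?_ ?_ ?_
  · intro i
    fin_cases i
    · exact ⟨⟨!![0, -1; 1, 0], by simp [det_fin_two_of]⟩, Or.inl (by decide)⟩
    · exact ⟨⟨!![1, 0; -1, 1], by simp [det_fin_two_of]⟩, Or.inr (by decide)⟩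
  · intro i j hij
    fin_cases i <;> fin_cases j <;> simp [Function.onFun, Set.disjoint_left, attracting] at hij ⊢ <;>
    intro g <;> omega
  · intro i j hij
    fin_cases i <;> fin_cases j <;> simp [Function.onFun, Set.disjoint_left, repelling] at hij ⊢ <;>
    intro g <;> have := column_ne_zero g <;> omega
  · intro i j
    fin_cases i <;> fin_cases j <;> simp [Set.disjoint_left, attracting, repelling] <;>
    intro g <;> omega
  · intro i
    rintro _ ⟨g, hg, rfl⟩
    have := column_ne_zero g
    fin_cases i <;>
    simp [attracting, repelling, smul_eq_mul, SL2Z_mul_apply, A_apply, B_apply] at hg ⊢ <;> omega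
  · intro i
    rintro _ ⟨g, hg, rfl⟩
    have := column_ne_zero g
    fin_cases i <;>
    simp [attracting, repelling, smul_eq_mul, SL2Z_mul_apply, A_apply, B_apply] at hg ⊢ <;> omega

theorem θ_eq_one_of_pow {w : F2} {n : ℕ} (hn : n ≠ 0) (h : θ w ^ n = 1) : θ w = 1 := by
  rw [← map_pow, ← map_one θ] at h
  have h₁ := θ_injective h
  rw [(pow_eq_one_iff_left hn).1 h₁, map_one]

/-- Trace zero would make `θ w` an element of order 4, but `F2` is torsion-free. The Markov descent
needs nonzero traces. -/
theorem tr_θ_ne_zero (w : F2) : tr (θ w) ≠ 0 := by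
  intro h
  have hdet := SL2Z_det (θ w)
  have h₁ : θ w ^ 2 = -1 := by
    simp only [tr] at h
    have h' : θ w 1 1 = -θ w 0 0 := by linarith
    rw [h'] at hdet
    apply SL2Z_ext <;> rw [sq, SL2Z_mul_apply] <;> simp [h'] <;> linarith
  have h₂ : θ w = 1 := θ_eq_one_of_pow (n := 4) (by norm_num) (by
    rw [show 4 = 2 * 2 by norm_num, pow_mul, h₁]; simp)
  simp [h₂] at h

theorem θ_ne_neg (v w : F2) : θ v ≠ -θ w := by
  intro h
  have h₁ : θ (v * w⁻¹) = -1 := by simp [h]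
  have h₂ : θ (v * w⁻¹) = 1 := θ_eq_one_of_pow (n := 2) (by norm_num) (by simp [h₁])
  rw [h₁] at h₂
  have := congrArg tr h₂
  simp [tr_neg] at this

theorem coe_comm_A_B : ((comm A B : SL2Z) : Matrix (Fin 2) (Fin 2) ℤ) = !![-1, 6; 0, -1] := by
  decide

theorem tr_comm_A_B : tr (comm A B) = -2 := by
  simp only [tr, coe_comm_A_B]
  simp

/-! ### Reduction modulo three -/

/-- The reduction of `θ` modulo three. -/
def θ₃ : F2 →* Matrix.SpecialLinearGroup (Fin 2) (ZMod 3) :=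
  (Matrix.SpecialLinearGroup.map (Int.castRingHom (ZMod 3))).comp θ

/-- The reduction of `A` modulo three. -/
def A₃ : Matrix.SpecialLinearGroup (Fin 2) (ZMod 3) := ⟨!![1, 1; 1, 2], by decide⟩

/-- The reduction of `B` modulo three. -/
def B₃ : Matrix.SpecialLinearGroup (Fin 2) (ZMod 3) := ⟨!![1, 2; 2, 2], by decide⟩

/-- The quaternion group generated by `A₃` and `B₃`. -/
def Q₈ : Finset (Matrix.SpecialLinearGroup (Fin 2) (ZMod 3)) :=
  {1, -1, A₃, -A₃, B₃, -B₃, A₃ * B₃, -(A₃ * B₃)}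

theorem θ₃_mem_Q₈ (w : F2) : θ₃ w ∈ Q₈ := by
  have hmul : ∀ x ∈ Q₈, ∀ y ∈ Q₈, x * y ∈ Q₈ := by decide
  have hinv : ∀ x ∈ Q₈, x⁻¹ ∈ Q₈ := by decide
  induction w using FreeGroup.induction_on with
  | C1 => simp [Q₈]
  | of i =>
    fin_cases i
    · have : θ₃ t₁ = A₃ := by simp only [θ₃, MonoidHom.comp_apply, θ_t₁]; decide
      rw [Fin.zero_eta, this]
      decide
    · have : θ₃ t₂ = B₃ := by simp only [θ₃, MonoidHom.comp_apply, θ_t₂]; decide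
      rw [Fin.mk_one, this]
      decide
  | inv_of i h => rw [map_inv]; exact hinv _ h
  | mul x y hx hy => rw [map_mul]; exact hmul _ hx _ hy

/-- Commutators in the quaternion group are ±1, of trace ±2, which is nonzero modulo 3. -/
theorem not_three_dvd_tr_comm (v w : F2) : ¬(3 : ℤ) ∣ tr (comm (θ v) (θ w)) := by
  have key : ∀ x ∈ Q₈, ∀ y ∈ Q₈, (comm x y) 0 0 + (comm x y) 1 1 ≠ 0 := by decide
  intro h
  apply key _ (θ₃_mem_Q₈ v) _ (θ₃_mem_Q₈ w)
  rw [← map_comm] at h ⊢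
  have := (ZMod.intCast_zmod_eq_zero_iff_dvd (tr (θ (comm v w))) 3).2 h
  simpa [tr, θ₃] using this

/-- A surjective endomorphism preserves the trace of the commutator. -/
theorem tr_comm_of_surjective {φ : F2 →* F2} (hφ : Function.Surjective φ) :
    tr (comm (θ (φ t₁)) (θ (φ t₂))) = -2 := by
  obtain ⟨v, hv⟩ := hφ t₁
  obtain ⟨w, hw⟩ := hφ t₂
  have h₁ := two_sub_tr_comm_dvd (θ.comp φ) v w
  have h₂ := two_sub_tr_comm_dvd θ (φ t₁) (φ t₂)
  have h₃ := not_three_dvd_tr_comm (φ t₁) (φ t₂)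
  simp only [MonoidHom.comp_apply, hv, hw, θ_t₁, θ_t₂, tr_comm_A_B] at h₁ h₂
  generalize tr (comm (θ (φ t₁)) (θ (φ t₂))) = k at h₁ h₂ h₃
  obtain ⟨m, hm⟩ := h₁
  obtain ⟨n, hn⟩ := h₂
  have : m * n = 1 := by
    have : (4 : ℤ) * (m * n) = 4 * 1 := by
      linear_combination (-1) * hm - m * hn
    linarith
  -- 2 - k and 4 divide each other, so k is -2 or 6; 6 is a multiple of 3.
  rcases Int.isUnit_iff.1 (IsUnit.of_mul_eq_one_right _ this) with h | h <;> subst h <;> omega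

end Nielsen

namespace Nielsen

open scoped Matrix
open Matrix (mul_apply det_fin_two det_fin_two_of adjugate_fin_two_of)

/-! ### The kernel of the braid group in `SL(2, ℤ)` -/

namespace B3

theorem closure_a_b : Subgroup.closure {a, b} = ⊤ := by
  rw [← PresentedGroup.closure_range_of]
  congr 1
  ext x
  simp only [Set.mem_insert_iff, Set.mem_singleton_iff, Set.mem_range, Fin.exists_fin_two, a, b,
    eq_comm]

theorem s_sq_zpow_commute (k : ℤ) (g : B3) : (s ^ 2) ^ k * g = g * (s ^ 2) ^ k :=
  (Subgroup.mem_center_iff.1 (Subgroup.zpow_mem _ s_sq_mem_center k) g).symm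

theorem a_mul_s_mul_a : a * s * a = b⁻¹ * s ^ 2 := by
  rw [mul_assoc, s_mul_a, eq_inv_mul_iff_mul_eq, sq, ← mul_assoc, ← mul_assoc, ← braid, ← s]

theorem b_inv_mul_s_mul_b_inv : b⁻¹ * s * b⁻¹ = a := by
  rw [s, braid]
  group

theorem a_mul_s_mul_b_inv : a * s * b⁻¹ = s := by
  rw [← s_mul_b]
  group

theorem b_inv_mul_s_mul_a : b⁻¹ * s * a = s := by
  rw [mul_assoc, s_mul_a]
  group

/-- The monoid generated by `a` and `b⁻¹`. -/
def positive : Submonoid B3 := Submonoid.closure {a, b⁻¹}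

theorem a_mem_positive : a ∈ positive := Submonoid.subset_closure (by simp)

theorem b_inv_mem_positive : b⁻¹ ∈ positive := Submonoid.subset_closure (by simp)

/-- The elements `m sʲ` and `s m sʲ` with `m` in the monoid generated by `a` and `b⁻¹`. -/
def IsNormal (g : B3) : Prop :=
  ∃ m ∈ positive, ∃ j : ℤ, g = m * s ^ j ∨ g = s * (m * s ^ j)

theorem IsNormal.s_sq_zpow_mul {g : B3} (hg : IsNormal g) (k : ℤ) :
    IsNormal ((s ^ 2) ^ k * g) := by
  obtain ⟨m, hm, j, rfl | rfl⟩ := hg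
  · refine ⟨m, hm, j + 2 * k, Or.inl ?_⟩
    rw [s_sq_zpow_commute, mul_assoc, zpow_add, zpow_mul, zpow_ofNat]
  · refine ⟨m, hm, j + 2 * k, Or.inr ?_⟩
    rw [s_sq_zpow_commute, mul_assoc, mul_assoc, zpow_add, zpow_mul, zpow_ofNat]

theorem IsNormal.s_mul {g : B3} (hg : IsNormal g) : IsNormal (s * g) := by
  obtain ⟨m, hm, j, rfl | rfl⟩ := hg
  · exact ⟨m, hm, j, Or.inr rfl⟩
  · have := IsNormal.s_sq_zpow_mul ⟨m, hm, j, Or.inl rfl⟩ 1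
    rwa [zpow_one, sq, mul_assoc] at this

theorem IsNormal.s_inv_mul {g : B3} (hg : IsNormal g) : IsNormal (s⁻¹ * g) := by
  have := (hg.s_sq_zpow_mul (-1)).s_mul
  rwa [← mul_assoc, show s * (s ^ 2) ^ (-1 : ℤ) = s⁻¹ by group] at this

/-- Only the first letter after `s` matters: a s a = b⁻¹ s² removes the leading `s`, while a s b⁻¹ =
s absorbs two letters. -/
theorem IsNormal.a_mul {g : B3} (hg : IsNormal g) : IsNormal (a * g) := by
  obtain ⟨m, hm, j, rfl | rfl⟩ := hg
  · exact ⟨a * m, mul_mem a_mem_positive hm, j, Or.inl (mul_assoc _ _ _).symm⟩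
  · induction hm using Submonoid.closure_induction_left with
    | one => exact ⟨a, a_mem_positive, 1 + j, Or.inl (by rw [zpow_add, zpow_one, one_mul])⟩
    | mul_left y hy m hm _ =>
      rcases hy with rfl | rfl
      · have := IsNormal.s_sq_zpow_mul
          ⟨b⁻¹ * m, mul_mem b_inv_mem_positive hm, j, Or.inl rfl⟩ 1
        have h : a * (s * (a * m * s ^ j)) = a * s * a * (m * s ^ j) := by group
        rw [h, a_mul_s_mul_a]
        rwa [zpow_one, ← zpow_one (s ^ 2), mul_assoc, ← mul_assoc, s_sq_zpow_commute,
          zpow_one] at this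
      · have h : a * (s * (b⁻¹ * m * s ^ j)) = a * s * b⁻¹ * (m * s ^ j) := by group
        rw [h, a_mul_s_mul_b_inv]
        exact ⟨m, hm, j, Or.inr rfl⟩

theorem IsNormal.b_inv_mul {g : B3} (hg : IsNormal g) : IsNormal (b⁻¹ * g) := by
  obtain ⟨m, hm, j, rfl | rfl⟩ := hg
  · exact ⟨b⁻¹ * m, mul_mem b_inv_mem_positive hm, j, Or.inl (mul_assoc _ _ _).symm⟩
  · induction hm using Submonoid.closure_induction_left with
    | one => exact ⟨b⁻¹, b_inv_mem_positive, 1 + j, Or.inl (by rw [zpow_add, zpow_one, one_mul])⟩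
    | mul_left y hy m hm _ =>
      rcases hy with rfl | rfl
      · have h : b⁻¹ * (s * (a * m * s ^ j)) = b⁻¹ * s * a * (m * s ^ j) := by group
        rw [h, b_inv_mul_s_mul_a]
        exact ⟨m, hm, j, Or.inr rfl⟩
      · have h : b⁻¹ * (s * (b⁻¹ * m * s ^ j)) = b⁻¹ * s * b⁻¹ * (m * s ^ j) := by group
        rw [h, b_inv_mul_s_mul_b_inv]
        exact ⟨a * m, mul_mem a_mem_positive hm, j, Or.inl (mul_assoc _ _ _).symm⟩

/-- Conjugation by `s` turns `a` into `b` and `b⁻¹` into `a⁻¹`, so stability under `a`, `b⁻¹`, `s`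
and `s⁻¹` suffices. -/
theorem isNormal (g : B3) : IsNormal g := by
  have hg : g ∈ Subgroup.closure {a, b} := by rw [closure_a_b]; trivial
  induction hg using Subgroup.closure_induction_left with
  | one => exact ⟨1, one_mem _, 0, Or.inl (by simp)⟩
  | mul_left x hx y _ ih =>
    rcases hx with rfl | rfl
    · exact ih.a_mul
    · have := ih.s_inv_mul.a_mul.s_mul
      rwa [← mul_assoc, ← mul_assoc, s_mul_a, mul_inv_cancel_right] at this
  | inv_mul_cancel x hx y _ ih =>
    rcases hx with rfl | rfl
    · have := ih.s_inv_mul.b_inv_mul.s_mul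
      have h : s * b⁻¹ * s⁻¹ = a⁻¹ := by
        rw [← inv_inj, ← mul_inv_cancel_right a s, ← s_mul_b]
        group
      rwa [← mul_assoc, ← mul_assoc, h] at this
    · exact ih.b_inv_mul

end B3

/-! ### The linear action of `B3` and its consequences -/

/-- The action of `B3` on the abelianization of `F2`. -/
def η : B3 →* Matrix.GeneralLinearGroup (Fin 2) ℤ := ρ.comp Ψ

theorem coe_ρ (x : MulAut F2) :
    (ρ x : Matrix (Fin 2) (Fin 2) ℤ) = abMatrix x.toMonoidHom := rfl

theorem coe_η_a : (η B3.a : Matrix (Fin 2) (Fin 2) ℤ) = !![1, -1; 0, 1] := by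
  rw [η, MonoidHom.comp_apply, Ψ_a, coe_ρ]
  ext i j
  fin_cases i <;> fin_cases j <;> simp [abMatrix, ab]

theorem coe_η_b : (η B3.b : Matrix (Fin 2) (Fin 2) ℤ) = !![1, 0; 1, 1] := by
  rw [η, MonoidHom.comp_apply, Ψ_b, coe_ρ]
  ext i j
  fin_cases i <;> fin_cases j <;> simp [abMatrix, ab]

theorem coe_η_b_inv : (η B3.b⁻¹ : Matrix (Fin 2) (Fin 2) ℤ) = !![1, 0; -1, 1] := by
  rw [map_inv, Matrix.coe_units_inv, coe_η_b, Matrix.inv_def]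
  simp [det_fin_two_of, adjugate_fin_two_of]

theorem coe_η_s : (η B3.s : Matrix (Fin 2) (Fin 2) ℤ) = !![0, -1; 1, 0] := by
  rw [B3.s, map_mul, map_mul, Units.val_mul, Units.val_mul, coe_η_a, coe_η_b]
  simp

theorem η_s_sq : η (B3.s ^ 2) = -1 := by
  ext i j
  rw [map_pow, Units.val_pow_eq_pow_val, coe_η_s]
  fin_cases i <;> fin_cases j <;> simp [sq]

/-- Both generators of the monoid act with diagonal 1 and nonpositive off-diagonal entries. No
cancellation occurs, so only the empty word is diagonal. -/
theorem η_positive {m : B3} (hm : m ∈ B3.positive) :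
    (1 ≤ (η m).1 0 0 ∧ 1 ≤ (η m).1 1 1 ∧ (η m).1 0 1 ≤ 0 ∧ (η m).1 1 0 ≤ 0) ∧
      (m = 1 ∨ (η m).1 0 1 + (η m).1 1 0 < 0) := by
  induction hm using Submonoid.closure_induction_left with
  | one => simp
  | mul_left x hx m _ ih =>
    obtain ⟨⟨h₁, h₂, h₃, h₄⟩, -⟩ := ih
    rcases hx with rfl | rfl
    · rw [map_mul, Units.val_mul, coe_η_a]
      generalize (η m).1 = M at *
      simp only [mul_apply, Fin.sum_univ_two]
      simp
      refine ⟨⟨?_, ?_, ?_, ?_⟩, Or.inr ?_⟩ <;> linarith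
    · rw [map_mul, Units.val_mul, coe_η_b_inv]
      generalize (η m).1 = M at *
      simp only [mul_apply, Fin.sum_univ_two]
      simp
      refine ⟨⟨?_, ?_, ?_, ?_⟩, Or.inr ?_⟩ <;> linarith

theorem η_s_sq_zpow (k : ℤ) : η ((B3.s ^ 2) ^ k) = 1 ∨ η ((B3.s ^ 2) ^ k) = -1 := by
  rw [map_zpow, η_s_sq]
  rcases Int.even_or_odd k with h | h
  · exact Or.inl h.neg_one_zpow
  · exact Or.inr h.neg_one_zpow

theorem mem_zpowers_s_sq_of_η_positive {m : B3} (hm : m ∈ B3.positive) {j : ℤ}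
    (h : η (m * B3.s ^ j) = 1 ∨ η (m * B3.s ^ j) = -1) :
    m * B3.s ^ j ∈ Subgroup.zpowers (B3.s ^ 2) := by
  obtain ⟨⟨h₁, h₂, h₃, h₄⟩, h₅⟩ := η_positive hm
  obtain ⟨l, rfl | rfl⟩ := Int.even_or_odd' j
  · have h₆ : η m = 1 ∨ η m = -1 := by
      rw [map_mul, zpow_mul, zpow_ofNat] at h
      rcases h with h | h <;> rcases η_s_sq_zpow l with h' | h' <;> rw [h'] at h <;>
      simp [neg_eq_iff_eq_neg] at h <;> simp [h]
    have h₇ : (η m).1 0 1 + (η m).1 1 0 = 0 := by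
      rcases h₆ with h₆ | h₆ <;> simp [h₆]
    rcases h₅ with rfl | h₅
    · rw [one_mul, zpow_mul, zpow_ofNat]
      exact Subgroup.zpow_mem _ (Subgroup.mem_zpowers _) l
    · omega
  · exfalso
    have h₆ : η m * η B3.s = 1 ∨ η m * η B3.s = -1 := by
      rw [map_mul, zpow_add, zpow_mul, zpow_ofNat, zpow_one, B3.s_sq_zpow_commute, map_mul,
        ← mul_assoc] at h
      rcases h with h | h <;> rcases η_s_sq_zpow l with h' | h' <;> rw [h'] at h <;>
      simp [neg_eq_iff_eq_neg] at h <;> simp [h]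
    -- This entry is the lower diagonal entry of `η m`, which is at least 1.
    have h₇ : (η m * η B3.s).1 1 0 = 0 := by
      rcases h₆ with h₆ | h₆ <;> simp [h₆]
    rw [Units.val_mul, coe_η_s] at h₇
    simp [mul_apply, Fin.sum_univ_two] at h₇
    omega

theorem mem_zpowers_s_sq_of_η {c : B3} (h : η c = 1 ∨ η c = -1) :
    c ∈ Subgroup.zpowers (B3.s ^ 2) := by
  obtain ⟨m, hm, j, rfl | rfl⟩ := B3.isNormal c
  · exact mem_zpowers_s_sq_of_η_positive hm h
  · have h₁ : m * B3.s ^ (j + 1) = B3.s⁻¹ * (B3.s * (m * B3.s ^ j)) * B3.s := by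
      rw [zpow_add, zpow_one]; group
    have h₂ : m * B3.s ^ (j + 1) ∈ Subgroup.zpowers (B3.s ^ 2) := by
      apply mem_zpowers_s_sq_of_η_positive hm
      rw [h₁, map_mul, map_mul η B3.s⁻¹]
      rcases h with h | h <;> simp [h]
    have h₃ : B3.s * (m * B3.s ^ j) = m * B3.s ^ (j + 1) := by
      obtain ⟨k, hk⟩ := h₂
      have h₄ := B3.s_sq_zpow_commute k B3.s
      simp only at hk
      rw [hk, h₁] at h₄
      have h₅ : B3.s * (m * B3.s ^ j) = B3.s * (B3.s⁻¹ * (B3.s * (m * B3.s ^ j)) * B3.s) * B3.s⁻¹ := by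
        group
      rw [h₅, ← h₄, mul_inv_cancel_right, h₁]
    rwa [h₃]

theorem ker_η : η.ker = B3.Y := by
  ext c
  rw [MonoidHom.mem_ker]
  constructor
  · intro h
    obtain ⟨k, rfl⟩ := mem_zpowers_s_sq_of_η (Or.inl h)
    simp only [map_zpow, η_s_sq] at h
    rcases Int.even_or_odd' k with ⟨l, rfl | rfl⟩
    · refine ⟨l, ?_⟩
      simp only [zpow_mul, zpow_ofNat, ← pow_mul]
    · rw [(odd_two_mul_add_one l).neg_one_zpow] at h
      have := congrArg (fun g : Matrix.GeneralLinearGroup (Fin 2) ℤ => g.1 0 0) h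
      simp at this
  · rintro ⟨k, rfl⟩
    simp only [map_zpow]
    rw [show B3.s ^ 4 = (B3.s ^ 2) ^ 2 by group, map_pow, η_s_sq]
    simp

/-- The kernel lies in `ker η = Y`, where `s ^ 4` acts as conjugation by an element of infinite
order. -/
theorem Ψ_injective : Function.Injective Ψ := by
  rw [injective_iff_map_eq_one]
  intro c hc
  have hY : c ∈ B3.Y := by
    rw [← ker_η, MonoidHom.mem_ker, η, MonoidHom.comp_apply, hc, map_one]
  have h : κ ⟨c, hY⟩ = κ 1 := by
    rw [map_one]
    exact Subtype.ext hc
  exact congrArg Subtype.val (amalgamConditions.κ_injective h)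

/-- A matrix commuting with both unipotent generators is scalar, hence ±1. -/
theorem center_B3 : Subgroup.center B3 = Subgroup.zpowers (B3.s ^ 2) := by
  apply le_antisymm
  · intro c hc
    apply mem_zpowers_s_sq_of_η
    rw [Subgroup.mem_center_iff] at hc
    have ha := congrArg (fun g => (η g).1) (hc B3.a)
    have hb := congrArg (fun g => (η g).1) (hc B3.b)
    simp only [map_mul, Units.val_mul, coe_η_a, coe_η_b] at ha hb
    have hdet : IsUnit (η c).1.det := (Matrix.isUnit_iff_isUnit_det _).1 (η c).isUnit
    rw [det_fin_two] at hdet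
    have h₁ := congrFun₂ ha 0 0
    have h₂ := congrFun₂ ha 0 1
    have h₃ := congrFun₂ hb 0 0
    simp [mul_apply, Fin.sum_univ_two] at h₁ h₂ h₃
    have h₄ : (η c).1 1 1 = (η c).1 0 0 := by linarith
    rw [h₄, h₁, mul_zero, sub_zero] at hdet
    have h₅ : IsUnit ((η c).1 0 0) := isUnit_of_mul_isUnit_left hdet
    rcases Int.isUnit_iff.1 h₅ with h₅ | h₅
    · left
      ext i j
      fin_cases i <;> fin_cases j <;> simp [h₁, h₃, h₄, h₅]
    · right
      ext i j
      fin_cases i <;> fin_cases j <;> simp [h₁, h₃, h₄, h₅]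
  · rw [Subgroup.zpowers_le]
    exact B3.s_sq_mem_center

theorem relIndex_Y : B3.Y.relIndex (Subgroup.center B3) = 2 := by
  rw [← ker_η, Subgroup.relIndex_ker, center_B3, MonoidHom.map_zpowers, η_s_sq, Nat.card_zpowers]
  refine orderOf_eq_prime (by simp) fun h => ?_
  have := congrArg (fun g : Matrix.GeneralLinearGroup (Fin 2) ℤ => g.1 0 0) h
  simp at this

theorem IntF2_le_ker_ρ : IntF2 ≤ ρ.ker := by
  rintro _ ⟨x, rfl⟩
  rw [MonoidHom.mem_ker]
  apply Units.ext
  rw [coe_ρ, Units.val_one, ← abMatrix_id]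
  ext i j
  simp [abMatrix, MulAut.conj_apply]

theorem IntF2_inf_range_Ψ : IntF2 ⊓ Ψ.range = B3.Y.map Ψ := by
  ext x
  constructor
  · rintro ⟨hx, c, rfl⟩
    refine ⟨c, ?_, rfl⟩
    rw [SetLike.mem_coe, ← ker_η]
    exact IntF2_le_ker_ρ hx
  · rintro ⟨c, hc, rfl⟩
    exact ⟨(κ ⟨c, hc⟩).2, c, rfl⟩

end Nielsen

namespace Nielsen

open scoped Matrix
open ModularGroup (S T)

/-! ### Descent on Markov triples -/

theorem markov_abs_step {a b c : ℤ} (ha : 0 < a) (hb : 0 < b) (hac : a ≤ c) (hbc : b ≤ c)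
    (h : a ^ 2 + b ^ 2 + c ^ 2 = a * b * c) :
    (a = 3 ∧ b = 3 ∧ c = 3) ∨ |a * b - c| < c := by
  wlog hab : a ≤ b generalizing a b
  · have := this hb ha hbc hac (by linarith) (by omega)
    rw [mul_comm b a] at this
    tauto
  have hpos : 0 < a * b - c := by
    have : 0 < c * (a * b - c) := by nlinarith
    exact pos_of_mul_pos_right this (by omega)
  by_cases hlt : a * b - c < c
  · right
    rw [abs_of_pos hpos]
    exact hlt
  left
  have ha1 : a ≠ 1 := by
    rintro rfl
    omega
  have ha2 : a ≠ 2 := by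
    rintro rfl
    have : c = b := by omega
    subst this
    nlinarith
  -- The roots c and ab - c of t² - abt + a² + b² are both at least b, so its value at b is
  -- nonnegative.
  have h₁ : 0 ≤ (c - b) * (a * b - c - b) := mul_nonneg (by omega) (by omega)
  have h₂ : b ^ 2 * (a - 2) ≤ a ^ 2 := by nlinarith
  have h₃ : b ^ 2 * (a - 3) ≤ a ^ 2 - b ^ 2 := by linarith
  have h₄ : a ^ 2 ≤ b ^ 2 := by nlinarith
  have h₅ : a = b := by
    have : 0 ≤ b ^ 2 * (a - 3) := mul_nonneg (sq_nonneg _) (by omega)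
    nlinarith
  subst h₅
  have h₆ : a = 3 := by
    by_contra h₆
    have : 0 < a ^ 2 * (a - 3) := mul_pos (by positivity) (by omega)
    linarith
  subst h₆
  -- For c = 6 the other root is 3, contrary to ab - c ≥ c.
  have h₇ : (c - 3) * (c - 6) = 0 := by linarith
  rcases mul_eq_zero.1 h₇ with h₈ | h₈ <;> omega

theorem markov_step {x y z : ℤ} (hx : x ≠ 0) (hy : y ≠ 0) (hxz : |x| ≤ |z|) (hyz : |y| ≤ |z|)
    (h : x ^ 2 + y ^ 2 + z ^ 2 = x * y * z) :
    (|x| = 3 ∧ |y| = 3 ∧ |z| = 3) ∨ |x * y - z| < |z| := by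
  have hpos : 0 < x * y * z := by rw [← h]; positivity
  have h₁ : |x| ^ 2 + |y| ^ 2 + |z| ^ 2 = |x| * |y| * |z| := by
    rw [sq_abs, sq_abs, sq_abs, h, ← abs_mul, ← abs_mul, abs_of_pos hpos]
  have h₂ := markov_abs_step (abs_pos.2 hx) (abs_pos.2 hy) hxz hyz h₁
  have h₃ : |x * y - z| = |(|x| * |y| - |z|)| := by
    rw [← abs_mul]
    rcases mul_pos_iff.1 hpos with ⟨h₄, h₅⟩ | ⟨h₄, h₅⟩
    · rw [abs_of_pos h₄, abs_of_pos h₅]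
    · rw [abs_of_neg h₄, abs_of_neg h₅, ← abs_neg]
      congr 1
      ring
  rwa [h₃]

theorem Ψ_comm (c : B3) : Ψ c (comm t₁ t₂) = comm t₁ t₂ := by
  have hc : c ∈ Subgroup.closure {B3.a, B3.b} := by rw [B3.closure_a_b]; trivial
  induction hc using Subgroup.closure_induction with
  | mem x hx =>
    rcases hx with rfl | rfl
    · rw [Ψ_a]; simp [comm, mul_assoc]
    · rw [Ψ_b]; simp [comm, mul_assoc]
  | one => simp
  | mul x y _ _ hx hy => rw [map_mul, MulAut.mul_apply, hy, hx]
  | inv x _ hx => rw [map_inv, MulAut.inv_apply, MulEquiv.symm_apply_eq, hx]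

/-! ### Markov moves by braids -/

/-- The action of the braid group on homomorphisms from `F2` by precomposition. -/
def act (f : F2 →* SL2Z) (c : B3) : F2 →* SL2Z := f.comp (Ψ c).toMonoidHom

theorem act_apply (f : F2 →* SL2Z) (c : B3) (w : F2) : act f c w = f (Ψ c w) := rfl

theorem act_act (f : F2 →* SL2Z) (c d : B3) : act (act f c) d = act f (c * d) := by
  ext w : 1
  simp [act]

theorem act_comm (f : F2 →* SL2Z) (c : B3) :
    comm (act f c t₁) (act f c t₂) = comm (f t₁) (f t₂) := by
  rw [← map_comm, ← map_comm, act_apply, Ψ_comm]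

theorem Ψ_b_mul_a_t₁ : Ψ (B3.b * B3.a) t₁ = t₂ * t₁ := by
  simp [Ψ_a, Ψ_b, MulAut.mul_apply]

theorem Ψ_b_mul_a_t₂ : Ψ (B3.b * B3.a) t₂ = t₁⁻¹ := by
  simp [Ψ_a, Ψ_b, MulAut.mul_apply]

/-- The traces of the images of `t₁`, `t₂` and `t₂ t₁`. -/
def traces (f : F2 →* SL2Z) : ℤ × ℤ × ℤ := (tr (f t₁), tr (f t₂), tr (f t₂ * f t₁))

theorem traces_act_b_mul_a (f : F2 →* SL2Z) :
    traces (act f (B3.b * B3.a)) = ((traces f).2.2, (traces f).1, (traces f).2.1) := by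
  simp only [traces, act_apply, Ψ_b_mul_a_t₁, Ψ_b_mul_a_t₂]
  rw [map_mul, map_inv, tr_inv, tr_mul_comm (f t₁)⁻¹, mul_inv_cancel_right]

theorem traces_act_a (f : F2 →* SL2Z) :
    traces (act f B3.a) =
      ((traces f).1, (traces f).1 * (traces f).2.1 - (traces f).2.2, (traces f).2.1) := by
  simp [traces, act_apply, Ψ_a]
  constructor
  · rw [tr_inv_mul, tr_mul_comm (f t₁)]
  · rw [mul_assoc, tr_mul_comm, mul_assoc, mul_inv_cancel, mul_one]

/-- The sum of the absolute values of the traces. -/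
def height (f : F2 →* SL2Z) : ℕ :=
  (traces f).1.natAbs + (traces f).2.1.natAbs + (traces f).2.2.natAbs

/-- All the traces are equal to `3` up to sign. -/
def IsReduced (f : F2 →* SL2Z) : Prop :=
  |(traces f).1| = 3 ∧ |(traces f).2.1| = 3 ∧ |(traces f).2.2| = 3

theorem markov_traces {f : F2 →* SL2Z} (h : tr (comm (f t₁) (f t₂)) = -2) :
    (traces f).1 ^ 2 + (traces f).2.1 ^ 2 + (traces f).2.2 ^ 2 =
      (traces f).1 * (traces f).2.1 * (traces f).2.2 := by
  rw [tr_comm] at h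
  simp only [traces]
  linarith

theorem descent_step {f : F2 →* SL2Z} (h₀ : ∀ w, tr (f w) ≠ 0)
    (h : tr (comm (f t₁) (f t₂)) = -2) (h₁ : |(traces f).1| ≤ |(traces f).2.2|)
    (h₂ : |(traces f).2.1| ≤ |(traces f).2.2|) :
    IsReduced f ∨ height (act f B3.a) < height f := by
  refine (markov_step (h₀ t₁) (h₀ t₂) h₁ h₂ (markov_traces h)).imp id fun h₃ => ?_
  have h₄ : |(traces f).1 * (traces f).2.1 - (traces f).2.2| < |(traces f).2.2| := h₃
  rw [Int.abs_eq_natAbs, Int.abs_eq_natAbs] at h₄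
  simp only [height, traces_act_a]
  omega

theorem exists_act_isReduced (f : F2 →* SL2Z) (h₀ : ∀ w, tr (f w) ≠ 0)
    (h : tr (comm (f t₁) (f t₂)) = -2) : ∃ c, IsReduced (act f c) := by
  induction hn : height f using Nat.strong_induction_on generalizing f with
  | _ n ih =>
    have key : ∀ c, height (act f c) = height f →
        |(traces (act f c)).1| ≤ |(traces (act f c)).2.2| →
        |(traces (act f c)).2.1| ≤ |(traces (act f c)).2.2| → ∃ c, IsReduced (act f c) := by
      intro c hc h₁ h₂
      rcases descent_step (f := act f c) (fun w => h₀ _) (by rw [act_comm, h]) h₁ h₂ with h₃ | h₃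
      · exact ⟨c, h₃⟩
      · rw [act_act] at h₃
        obtain ⟨d, hd⟩ := ih _ (by omega) (act f (c * B3.a)) (fun w => h₀ _)
          (by rw [act_comm, h]) rfl
        exact ⟨c * B3.a * d, by rwa [act_act] at hd⟩
    have h₁ := traces_act_b_mul_a f
    have h₂ := traces_act_b_mul_a (act f (B3.b * B3.a))
    have h₃ : act f 1 = f := by ext w : 1; simp [act]
    rw [act_act, h₁] at h₂
    -- Powers of `b * a` rotate the traces; one of the three rotations puts the largest absolute
    -- value last, where `a` lowers it.
    have k₀ := key 1 (by rw [h₃])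
    have k₁ := key (B3.b * B3.a) (by simp only [height, h₁]; omega)
    have k₂ := key (B3.b * B3.a * (B3.b * B3.a)) (by simp only [height, h₂]; omega)
    rw [h₃] at k₀
    rw [h₁] at k₁
    rw [h₂] at k₂
    simp only at k₀ k₁ k₂
    rcases le_total |(traces f).1| |(traces f).2.1| with h₄ | h₄ <;>
    rcases le_total |(traces f).2.1| |(traces f).2.2| with h₅ | h₅ <;>
    rcases le_total |(traces f).1| |(traces f).2.2| with h₆ | h₆ <;>
    first
    | exact k₀ (by linarith) (by linarith)
    | exact k₁ (by linarith) (by linarith)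
    | exact k₂ (by linarith) (by linarith)

/-! ### Pairs of matrices with traces `(3, 3, 3)` -/

theorem T_zpow_apply (k : ℤ) (i j : Fin 2) : (T ^ k) i j = !![1, k; 0, 1] i j := by
  rw [ModularGroup.coe_T_zpow]

theorem T_zpow_conj_A (k : ℤ) :
    (T ^ k * A * (T ^ k)⁻¹) 0 0 = 1 + k ∧ (T ^ k * A * (T ^ k)⁻¹) 1 0 = 1 ∧
      (T ^ k * A * (T ^ k)⁻¹) 1 1 = 2 - k := by
  simp [SL2Z_mul_apply, T_zpow_apply, A_apply]
  ring

theorem T_zpow_conj_B (k : ℤ) :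
    (T ^ k * B * (T ^ k)⁻¹) 0 0 = 1 - k ∧ (T ^ k * B * (T ^ k)⁻¹) 1 0 = -1 ∧
      (T ^ k * B * (T ^ k)⁻¹) 1 1 = 2 + k := by
  simp [SL2Z_mul_apply, T_zpow_apply, B_apply]
  constructor <;> ring

theorem SL2Z_ext_of_isUnit {g h : SL2Z} (h₀₀ : g 0 0 = h 0 0) (h₁₀ : g 1 0 = h 1 0)
    (h₁₁ : g 1 1 = h 1 1) (hh : h 1 0 ≠ 0) : g = h := by
  refine SL2Z_ext h₀₀ ?_ h₁₀ h₁₁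
  have hg := SL2Z_det g
  have hh' := SL2Z_det h
  rw [h₀₀, h₁₀, h₁₁] at hg
  exact mul_right_cancel₀ hh (by linarith)

/-- With K = [M, N], the elements MK, KN⁻¹ and NMK are conjugate to M, N⁻¹ and NM. As K is
triangular, equality of traces is linear in the lower-left entries. -/
theorem entries_of_traces {M N : SL2Z} {n : ℤ} (hM : tr M = 3) (hN : tr N = 3)
    (hNM : tr (N * M) = 3) (h₀₀ : comm M N 0 0 = -1) (h₀₁ : comm M N 0 1 = n)
    (h₁₀ : comm M N 1 0 = 0) (h₁₁ : comm M N 1 1 = -1) :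
    n * M 1 0 = 6 ∧ N 1 0 = -M 1 0 ∧ N 1 1 = M 0 0 + 1 := by
  have e₁ : tr (M * comm M N) = tr M := by
    rw [show M * comm M N = N⁻¹ * M * N by simp [comm, mul_assoc]]
    simpa using tr_conj N⁻¹ M
  have e₂ : tr (comm M N * N⁻¹) = tr N := by
    rw [show comm M N * N⁻¹ = M⁻¹ * N⁻¹ * M by simp [comm, mul_assoc], ← tr_inv N]
    simpa using tr_conj M⁻¹ N⁻¹
  have e₃ : tr (N * M * comm M N) = tr (N * M) := by
    rw [show N * M * comm M N = M * N by simp [comm, mul_assoc], tr_mul_comm]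
  generalize comm M N = K at *
  simp only [tr, SL2Z_mul_apply, SL2Z_inv_zero_zero, SL2Z_inv_zero_one, SL2Z_inv_one_zero,
    SL2Z_inv_one_one, h₀₀, h₀₁, h₁₀, h₁₁] at *
  have d₁ : n * M 1 0 = 6 := by linarith
  have hn : n ≠ 0 := by rintro rfl; simp at d₁
  have d₂ : N 1 0 = -M 1 0 := mul_left_cancel₀ hn (by linarith)
  have d₃ : N 1 0 * M 0 0 + N 1 1 * M 1 0 = M 1 0 := mul_left_cancel₀ hn (by linarith)
  have hM₀ : M 1 0 ≠ 0 := by intro h; simp [h] at d₁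
  refine ⟨d₁, d₂, mul_left_cancel₀ hM₀ ?_⟩
  rw [d₂] at d₃
  linarith

theorem eq_T_zpow_conj {M N : SL2Z} (hM : tr M = 3) (hN : tr N = 3) (hM₁₀ : M 1 0 = 1)
    (hN₁₀ : N 1 0 = -M 1 0) (hN₁₁ : N 1 1 = M 0 0 + 1) :
    ∃ k : ℤ, M = T ^ k * A * (T ^ k)⁻¹ ∧ N = T ^ k * B * (T ^ k)⁻¹ := by
  obtain ⟨a₁, a₂, a₃⟩ := T_zpow_conj_A (M 0 0 - 1)
  obtain ⟨b₁, b₂, b₃⟩ := T_zpow_conj_B (M 0 0 - 1)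
  simp only [tr] at hM hN
  refine ⟨M 0 0 - 1, SL2Z_ext_of_isUnit ?_ ?_ ?_ ?_, SL2Z_ext_of_isUnit ?_ ?_ ?_ ?_⟩ <;> omega

/-- By the determinant, the entry divides p² - 3p + 1, which is prime to 6; it also divides 6. -/
theorem entry_eq_one_or_neg_one {M : SL2Z} (hM : tr M = 3) {n : ℤ} (h : n * M 1 0 = 6) :
    M 1 0 = 1 ∨ M 1 0 = -1 := by
  have hdet := SL2Z_det M
  simp only [tr] at hM
  have h₁ : M 1 1 = 3 - M 0 0 := by linarith
  rw [h₁] at hdet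
  generalize M 0 0 = p at *
  generalize M 1 0 = c at *
  generalize M 0 1 = q at *
  have h₂ : c ∣ p ^ 2 - 3 * p + 1 := ⟨-q, by linarith⟩
  have hodd : ¬(2 : ℤ) ∣ p ^ 2 - 3 * p + 1 := by
    intro h
    have := (ZMod.intCast_zmod_eq_zero_iff_dvd (p ^ 2 - 3 * p + 1) 2).2 h
    push_cast at this
    revert this
    generalize (p : ZMod 2) = x
    revert x
    decide
  have hthree : ¬(3 : ℤ) ∣ p ^ 2 - 3 * p + 1 := by
    intro h
    have := (ZMod.intCast_zmod_eq_zero_iff_dvd (p ^ 2 - 3 * p + 1) 3).2 h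
    push_cast at this
    revert this
    generalize (p : ZMod 3) = x
    revert x
    decide
  have h2c : ¬(2 : ℤ) ∣ c := fun h => hodd (h.trans h₂)
  have h3c : ¬(3 : ℤ) ∣ c := fun h => hthree (h.trans h₂)
  have hc : c ∣ 6 := ⟨n, by linarith⟩
  have hc₁ : c ≤ 6 := Int.le_of_dvd (by norm_num) hc
  have hc₂ : -c ≤ 6 := Int.le_of_dvd (by norm_num) (neg_dvd.2 hc)
  have hc₃ : -6 ≤ c := by linarith
  interval_cases c <;> omega

/-- Change of the signs of the off-diagonal entries. -/
def negOffDiag (g : SL2Z) : SL2Z :=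
  ⟨!![g 0 0, -g 0 1; -g 1 0, g 1 1], by
    rw [Matrix.det_fin_two_of]; linear_combination SL2Z_det g⟩

theorem negOffDiag_apply (g : SL2Z) (i j : Fin 2) :
    negOffDiag g i j = !![g 0 0, -g 0 1; -g 1 0, g 1 1] i j := rfl

/-- Conjugation by the diagonal matrix with entries `1` and `-1`. -/
def flip : SL2Z →* SL2Z where
  toFun := negOffDiag
  map_one' := by apply SL2Z_ext <;> simp [negOffDiag_apply]
  map_mul' g h := by
    apply SL2Z_ext <;> simp [SL2Z_mul_apply, negOffDiag_apply] <;> ring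

theorem flip_apply (g : SL2Z) (i j : Fin 2) :
    flip g i j = !![g 0 0, -g 0 1; -g 1 0, g 1 1] i j := rfl

theorem flip_flip (g : SL2Z) : flip (flip g) = g := by
  apply SL2Z_ext <;> simp [flip_apply]

theorem flip_A : flip A = B := by
  apply SL2Z_ext <;> simp [flip_apply, A_apply, B_apply]

theorem flip_B : flip B = A := by
  rw [← flip_A, flip_flip]

theorem tr_flip (g : SL2Z) : tr (flip g) = tr g := by
  simp [tr, flip_apply]

theorem exists_T_zpow_conj {M N : SL2Z} (hM : tr M = 3) (hN : tr N = 3) (hNM : tr (N * M) = 3)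
    (h : comm M N = comm A B) :
    ∃ k : ℤ, M = T ^ k * A * (T ^ k)⁻¹ ∧ N = T ^ k * B * (T ^ k)⁻¹ := by
  obtain ⟨h₁, h₂, h₃⟩ := entries_of_traces (n := 6) hM hN hNM (by rw [h, coe_comm_A_B]; simp)
    (by rw [h, coe_comm_A_B]; simp) (by rw [h, coe_comm_A_B]; simp)
    (by rw [h, coe_comm_A_B]; simp)
  exact eq_T_zpow_conj hM hN (by linarith) h₂ h₃

theorem exists_conj_upper_triangular {K : SL2Z} (hK : tr K = -2) :
    ∃ g : SL2Z, (g * K * g⁻¹) 0 0 = -1 ∧ (g * K * g⁻¹) 1 0 = 0 ∧ (g * K * g⁻¹) 1 1 = -1 := by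
  suffices h : ∃ g : SL2Z, (g * K * g⁻¹) 1 0 = 0 by
    obtain ⟨g, hg⟩ := h
    have h₁ := SL2Z_det (g * K * g⁻¹)
    have h₂ := tr_conj g K
    rw [hK] at h₂
    rw [hg] at h₁
    simp only [tr] at h₂
    have h₃ : ((g * K * g⁻¹) 0 0 + 1) ^ 2 = 0 := by
      rw [show (g * K * g⁻¹) 1 1 = -2 - (g * K * g⁻¹) 0 0 by linarith] at h₁
      linarith
    have h₄ := pow_eq_zero_iff two_ne_zero |>.1 h₃
    exact ⟨g, by linarith, hg, by linarith⟩
  by_cases hc : K 1 0 = 0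
  · exact ⟨1, by simpa using hc⟩
  have hg : Int.gcd (K 0 0 + 1) (K 1 0) ≠ 0 := by
    rw [Ne, Int.gcd_eq_zero_iff]
    tauto
  -- As (K + 1)² = 0, the first column of K + 1 is an eigenvector for -1. Made primitive, it becomes
  -- the first column of g.
  obtain ⟨g, hg₀, hg₁⟩ := (Int.isCoprime_iff_gcd_eq_one.2
    (Int.gcd_ediv_gcd_ediv_gcd (Nat.pos_of_ne_zero hg))).exists_SL2_col 0
  have hdet := SL2Z_det K
  simp only [tr] at hK
  have e₀ : K 0 0 + 1 = Int.gcd (K 0 0 + 1) (K 1 0) * g 0 0 := by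
    rw [hg₀, Int.mul_ediv_cancel' (Int.gcd_dvd_left _ _)]
  have e₁ : K 1 0 = Int.gcd (K 0 0 + 1) (K 1 0) * g 1 0 := by
    rw [hg₁, Int.mul_ediv_cancel' (Int.gcd_dvd_right _ _)]
  refine ⟨g⁻¹, ?_⟩
  have hd : (Int.gcd (K 0 0 + 1) (K 1 0) : ℤ) ≠ 0 := by exact_mod_cast hg
  generalize (Int.gcd (K 0 0 + 1) (K 1 0) : ℤ) = d at e₀ e₁ hd
  have f₀ : K 0 0 * g 0 0 + K 0 1 * g 1 0 = -g 0 0 := mul_left_cancel₀ hd (by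
    linear_combination -(K 0 0 + 1) * e₀ - K 0 1 * e₁ - hdet + K 0 0 * hK)
  have f₁ : K 1 0 * g 0 0 + K 1 1 * g 1 0 = -g 1 0 := mul_left_cancel₀ hd (by
    linear_combination -K 1 0 * e₀ - (K 1 1 + 1) * e₁ + K 1 0 * hK)
  rw [inv_inv, SL2Z_mul_apply, SL2Z_mul_apply, SL2Z_mul_apply, SL2Z_inv_one_zero, SL2Z_inv_one_one]
  linear_combination -g 1 0 * f₀ + g 0 0 * f₁

theorem exists_conj_of_traces {M N : SL2Z} (hM : tr M = 3) (hN : tr N = 3)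
    (hNM : tr (N * M) = 3) :
    ∃ g : SL2Z, (M = g * A * g⁻¹ ∧ N = g * B * g⁻¹) ∨ (M = g * B * g⁻¹ ∧ N = g * A * g⁻¹) := by
  have hK : tr (comm M N) = -2 := by rw [tr_comm, hM, hN, hNM]; norm_num
  obtain ⟨g, h₀₀, h₁₀, h₁₁⟩ := exists_conj_upper_triangular hK
  have hconj : g * comm M N * g⁻¹ = comm (g * M * g⁻¹) (g * N * g⁻¹) := by
    simp [comm, mul_assoc]
  rw [hconj] at h₀₀ h₁₀ h₁₁
  have hM' : tr (g * M * g⁻¹) = 3 := by rw [tr_conj, hM]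
  have hN' : tr (g * N * g⁻¹) = 3 := by rw [tr_conj, hN]
  have hNM' : tr (g * N * g⁻¹ * (g * M * g⁻¹)) = 3 := by
    rw [show g * N * g⁻¹ * (g * M * g⁻¹) = g * (N * M) * g⁻¹ by group, tr_conj, hNM]
  have hinv : ∀ x : SL2Z, x = g⁻¹ * (g * x * g⁻¹) * g := fun x => by group
  obtain ⟨h₁, h₂, h₃⟩ := entries_of_traces hM' hN' hNM' h₀₀ rfl h₁₀ h₁₁
  rcases entry_eq_one_or_neg_one hM' h₁ with h₄ | h₄
  · obtain ⟨k, e₁, e₂⟩ := eq_T_zpow_conj hM' hN' h₄ h₂ h₃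
    refine ⟨g⁻¹ * T ^ k, Or.inl ⟨?_, ?_⟩⟩
    · rw [hinv M, e₁]; group
    · rw [hinv N, e₂]; group
  -- Lower-left entry -1: `flip` changes it to 1 and exchanges `A` with `B`, at the cost of the
  -- order of the pair.
  · obtain ⟨k, e₁, e₂⟩ := eq_T_zpow_conj (M := flip (g * M * g⁻¹)) (N := flip (g * N * g⁻¹))
      (by rw [tr_flip, hM']) (by rw [tr_flip, hN']) (by rw [flip_apply]; simp [h₄])
      (by rw [flip_apply, flip_apply]; simp [h₂]) (by rw [flip_apply, flip_apply]; simp [h₃])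
    have e₃ := congrArg flip e₁
    have e₄ := congrArg flip e₂
    rw [flip_flip, map_mul, map_mul, map_inv, flip_A] at e₃
    rw [flip_flip, map_mul, map_mul, map_inv, flip_B] at e₄
    refine ⟨g⁻¹ * flip (T ^ k), Or.inr ⟨?_, ?_⟩⟩
    · rw [hinv M, e₃]; group
    · rw [hinv N, e₄]; group

/-- Fricke's identity forces the product of the three traces to be 27, so an even number are
negative and sign changes of M and N correct them. -/
theorem exists_sign_of_traces {M N : SL2Z} (h : tr (comm M N) = -2) (hM : |tr M| = 3)
    (hN : |tr N| = 3) (hNM : |tr (N * M)| = 3) :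
    ∃ M' N' : SL2Z, (M = M' ∨ M = -M') ∧ (N = N' ∨ N = -N') ∧ comm M N = comm M' N' ∧
      tr M' = 3 ∧ tr N' = 3 ∧ tr (N' * M') = 3 := by
  rw [tr_comm] at h
  rcases (abs_eq (by norm_num)).1 hM with h₁ | h₁ <;>
  rcases (abs_eq (by norm_num)).1 hN with h₂ | h₂ <;>
  rcases (abs_eq (by norm_num)).1 hNM with h₃ | h₃ <;>
  rw [h₁, h₂, h₃] at h <;> norm_num at h
  · exact ⟨M, N, Or.inl rfl, Or.inl rfl, rfl, h₁, h₂, h₃⟩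
  · exact ⟨M, -N, Or.inl rfl, Or.inr (by simp), by rw [comm_neg_right], h₁,
      by rw [tr_neg, h₂, neg_neg], by rw [neg_mul, tr_neg, h₃, neg_neg]⟩
  · exact ⟨-M, N, Or.inr (by simp), Or.inl rfl, by rw [comm_neg_left],
      by rw [tr_neg, h₁, neg_neg], h₂, by rw [mul_neg, tr_neg, h₃, neg_neg]⟩
  · exact ⟨-M, -N, Or.inr (by simp), Or.inr (by simp), by rw [comm_neg_left, comm_neg_right],
      by rw [tr_neg, h₁, neg_neg], by rw [tr_neg, h₂, neg_neg], by rw [neg_mul_neg, h₃]⟩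

end Nielsen

namespace Nielsen

open ModularGroup (S T)

/-! ### Conjugation by `SL(2, ℤ)` -/

theorem F2_hom_ext {G : Type*} [Group G] {f g : F2 →* G} (h₁ : f t₁ = g t₁) (h₂ : f t₂ = g t₂) :
    f = g := by
  ext i
  fin_cases i
  · exact h₁
  · exact h₂

/-- The subgroup generated by the inner automorphisms and the image of the braid group. -/
def innerBraid : Subgroup (MulAut F2) := IntF2 ⊔ Ψ.range

theorem mem_innerBraid {x : MulAut F2} :
    x ∈ innerBraid ↔ ∃ h ∈ IntF2, ∃ c : B3, x = h * Ψ c := by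
  rw [innerBraid, Subgroup.mem_sup_of_normal_left]
  constructor
  · rintro ⟨h, hh, _, ⟨c, rfl⟩, rfl⟩
    exact ⟨h, hh, c, rfl⟩
  · rintro ⟨h, hh, c, rfl⟩
    exact ⟨h, hh, _, ⟨c, rfl⟩, rfl⟩

theorem Ψ_mem_innerBraid (c : B3) : Ψ c ∈ innerBraid := Subgroup.mem_sup_right ⟨c, rfl⟩

theorem conj_mem_innerBraid (x : F2) : MulAut.conj x ∈ innerBraid := Subgroup.mem_sup_left ⟨x, rfl⟩

theorem T_inv_conj_θ (w : F2) : T⁻¹ * θ w * T = θ (Ψ (B3.b * B3.a) w) := by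
  have h : (MulAut.conj T⁻¹).toMonoidHom.comp θ = act θ (B3.b * B3.a) := by
    apply F2_hom_ext
    · change T⁻¹ * θ t₁ * T⁻¹⁻¹ = θ (Ψ (B3.b * B3.a) t₁)
      rw [Ψ_b_mul_a_t₁, map_mul, θ_t₁, θ_t₂]
      decide
    · change T⁻¹ * θ t₂ * T⁻¹⁻¹ = θ (Ψ (B3.b * B3.a) t₂)
      rw [Ψ_b_mul_a_t₂, map_inv θ, θ_t₁, θ_t₂]
      decide
  have := DFunLike.congr_fun h w
  change T⁻¹ * θ w * T⁻¹⁻¹ = _ at this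
  rwa [inv_inv] at this

theorem T_zpow_conj_θ (k : ℤ) (w : F2) :
    T ^ k * θ w * (T ^ k)⁻¹ = θ (Ψ ((B3.b * B3.a) ^ (-k)) w) := by
  have h : ∀ x, T * θ x * T⁻¹ = θ (Ψ (B3.b * B3.a)⁻¹ x) := by
    intro x
    have := T_inv_conj_θ (Ψ (B3.b * B3.a)⁻¹ x)
    rw [← MulAut.mul_apply, ← map_mul, mul_inv_cancel, map_one, MulAut.one_apply] at this
    rw [← this]
    group
  induction k with
  | zero => simp
  | succ n ih =>
    rw [zpow_add_one, show T ^ (n : ℤ) * T = T * T ^ (n : ℤ) by group,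
      show T * T ^ (n : ℤ) * θ w * (T * T ^ (n : ℤ))⁻¹
        = T * (T ^ (n : ℤ) * θ w * (T ^ (n : ℤ))⁻¹) * T⁻¹ by group, ih, h, ← MulAut.mul_apply,
      ← map_mul]
    congr 3
    generalize B3.b * B3.a = x
    group
  | pred n ih =>
    rw [zpow_sub_one, show T ^ (-n : ℤ) * T⁻¹ = T⁻¹ * T ^ (-n : ℤ) by group,
      show T⁻¹ * T ^ (-n : ℤ) * θ w * (T⁻¹ * T ^ (-n : ℤ))⁻¹
        = T⁻¹ * (T ^ (-n : ℤ) * θ w * (T ^ (-n : ℤ))⁻¹) * T by group, ih, T_inv_conj_θ,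
      ← MulAut.mul_apply, ← map_mul]
    congr 3
    generalize B3.b * B3.a = x
    group

theorem S_conj_θ (w : F2) :
    S * θ w * S⁻¹ = θ ((MulAut.conj (t₂ * t₁) * Ψ (B3.s ^ 2)) w) := by
  have h : (MulAut.conj S).toMonoidHom.comp θ =
      θ.comp (MulAut.conj (t₂ * t₁) * Ψ (B3.s ^ 2)).toMonoidHom := by
    have hs : Ψ (B3.s ^ 2) = (α * β * α) ^ 2 := by
      rw [map_pow, B3.s, map_mul, map_mul, Ψ_a, Ψ_b]
    have h₁ : (MulAut.conj (t₂ * t₁) * Ψ (B3.s ^ 2)) t₁ = t₁⁻¹ := by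
      rw [hs]
      simp [sq, MulAut.mul_apply, MulAut.conj_apply, mul_assoc]
    have h₂ : (MulAut.conj (t₂ * t₁) * Ψ (B3.s ^ 2)) t₂ = t₂⁻¹ := by
      rw [hs]
      simp [sq, MulAut.mul_apply, MulAut.conj_apply, mul_assoc]
    apply F2_hom_ext
    · change S * θ t₁ * S⁻¹ = θ ((MulAut.conj (t₂ * t₁) * Ψ (B3.s ^ 2)) t₁)
      rw [h₁, map_inv, θ_t₁]
      decide
    · change S * θ t₂ * S⁻¹ = θ ((MulAut.conj (t₂ * t₁) * Ψ (B3.s ^ 2)) t₂)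
      rw [h₂, map_inv, θ_t₂]
      decide
  exact DFunLike.congr_fun h w

/-- It suffices to treat the generators: `T⁻¹` acts as the braid `b * a`, and `S` inverts both
generators, which is `s ^ 2` followed by an inner automorphism. -/
theorem exists_conj_θ (g : SL2Z) : ∃ τ ∈ innerBraid, ∀ w, g * θ w * g⁻¹ = θ (τ w) := by
  have hg : g ∈ Subgroup.closure {S, T} := by
    rw [SpecialLinearGroup.SL2Z_generators]; trivial
  induction hg using Subgroup.closure_induction with
  | mem x hx =>
    rcases hx with rfl | rfl
    · exact ⟨_, mul_mem (conj_mem_innerBraid _) (Ψ_mem_innerBraid _), S_conj_θ⟩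
    · refine ⟨_, Ψ_mem_innerBraid ((B3.b * B3.a) ^ (-1 : ℤ)), fun w => ?_⟩
      have := T_zpow_conj_θ 1 w
      rwa [zpow_one] at this
  | one => exact ⟨1, one_mem _, by simp⟩
  | mul x y _ _ hx hy =>
    obtain ⟨σ, hσ, hσ'⟩ := hx
    obtain ⟨τ, hτ, hτ'⟩ := hy
    refine ⟨σ * τ, mul_mem hσ hτ, fun w => ?_⟩
    rw [MulAut.mul_apply, ← hσ', ← hτ']
    group
  | inv x _ hx =>
    obtain ⟨σ, hσ, hσ'⟩ := hx
    refine ⟨σ⁻¹, inv_mem hσ, fun w => ?_⟩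
    have := hσ' (σ⁻¹ w)
    rw [MulAut.apply_inv_self] at this
    rw [← this]
    group

/-! ### Classification of endomorphisms by the commutator -/

/-- The automorphism that exchanges the generators. -/
def swap : MulAut F2 := FreeGroup.freeGroupCongr (Equiv.swap 0 1)

@[simp] theorem swap_t₁ : swap t₁ = t₂ := by simp [swap]

@[simp] theorem swap_t₂ : swap t₂ = t₁ := by simp [swap]

theorem eq_of_θ_eq_or_neg {v w : F2} (h : θ v = θ w ∨ θ v = -θ w) : v = w :=
  h.elim (fun h => θ_injective h) fun h => absurd h (θ_ne_neg v w)

theorem eq_of_comp_Ψ_eq {φ : F2 →* F2} {c : B3} {τ : MulAut F2} (h₁ : φ (Ψ c t₁) = τ t₁)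
    (h₂ : φ (Ψ c t₂) = τ t₂) : φ = (τ * Ψ c⁻¹).toMonoidHom := by
  have h : φ.comp (Ψ c).toMonoidHom = τ.toMonoidHom := F2_hom_ext h₁ h₂
  refine MonoidHom.ext fun w => ?_
  have := DFunLike.congr_fun h (Ψ c⁻¹ w)
  simpa [map_inv, MulAut.mul_apply] using this

theorem exists_reduction {φ : F2 →* F2} (h : tr (comm (θ (φ t₁)) (θ (φ t₂))) = -2) :
    ∃ (c : B3) (M N : SL2Z), (θ (φ (Ψ c t₁)) = M ∨ θ (φ (Ψ c t₁)) = -M) ∧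
      (θ (φ (Ψ c t₂)) = N ∨ θ (φ (Ψ c t₂)) = -N) ∧
      comm M N = comm (θ (φ t₁)) (θ (φ t₂)) ∧ tr M = 3 ∧ tr N = 3 ∧ tr (N * M) = 3 := by
  obtain ⟨c, h₁, h₂, h₃⟩ := exists_act_isReduced (θ.comp φ) (fun w => tr_θ_ne_zero _) h
  have hc := act_comm (θ.comp φ) c
  obtain ⟨M, N, hM, hN, hMN, h₄⟩ := exists_sign_of_traces (by rw [hc]; exact h) h₁ h₂ h₃
  exact ⟨c, M, N, hM, hN, by rw [← hMN, hc]; rfl, h₄⟩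

theorem exists_eq_of_tr_comm {φ : F2 →* F2} (h : tr (comm (θ (φ t₁)) (θ (φ t₂))) = -2) :
    ∃ τ ∈ innerBraid, ∃ c, φ = (τ * Ψ c).toMonoidHom ∨ φ = (τ * swap * Ψ c).toMonoidHom := by
  obtain ⟨c, M, N, hM, hN, -, h₁, h₂, h₃⟩ := exists_reduction h
  obtain ⟨g, hg⟩ := exists_conj_of_traces h₁ h₂ h₃
  obtain ⟨τ, hτ, hτ'⟩ := exists_conj_θ g
  rw [← θ_t₁, ← θ_t₂, hτ', hτ'] at hg
  refine ⟨τ, hτ, c⁻¹, ?_⟩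
  rcases hg with ⟨rfl, rfl⟩ | ⟨rfl, rfl⟩
  · exact Or.inl (eq_of_comp_Ψ_eq (eq_of_θ_eq_or_neg hM) (eq_of_θ_eq_or_neg hN))
  · refine Or.inr (eq_of_comp_Ψ_eq ?_ ?_)
    · rw [MulAut.mul_apply, swap_t₁]; exact eq_of_θ_eq_or_neg hM
    · rw [MulAut.mul_apply, swap_t₂]; exact eq_of_θ_eq_or_neg hN

/-- Fixing the commutator fixes its upper-right entry 6, so the lower-left entry is 1: the pair is
conjugate to (A, B) by a power of `T`, hence by a braid. -/
theorem exists_Ψ_eq_iff (φ : F2 →* F2) :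
    (∃ c : B3, φ = (Ψ c).toMonoidHom) ↔ comm (φ t₁) (φ t₂) = comm t₁ t₂ := by
  constructor
  · rintro ⟨c, rfl⟩
    rw [← map_comm]
    exact Ψ_comm c
  · intro h
    have hθ : comm (θ (φ t₁)) (θ (φ t₂)) = comm A B := by
      rw [← map_comm, h, map_comm, θ_t₁, θ_t₂]
    obtain ⟨c, M, N, hM, hN, hMN, h₁, h₂, h₃⟩ := exists_reduction (φ := φ)
      (by rw [hθ, tr_comm_A_B])
    obtain ⟨k, hk⟩ := exists_T_zpow_conj h₁ h₂ h₃ (hMN.trans hθ)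
    rw [← θ_t₁, ← θ_t₂, T_zpow_conj_θ, T_zpow_conj_θ] at hk
    obtain ⟨rfl, rfl⟩ := hk
    refine ⟨(B3.b * B3.a) ^ (-k) * c⁻¹, ?_⟩
    rw [map_mul]
    exact eq_of_comp_Ψ_eq (eq_of_θ_eq_or_neg hM) (eq_of_θ_eq_or_neg hN)

theorem bijective_of_surjective {φ : F2 →* F2} (hφ : Function.Surjective φ) :
    Function.Bijective φ := by
  obtain ⟨τ, -, c, rfl | rfl⟩ := exists_eq_of_tr_comm (tr_comm_of_surjective hφ)
  · exact (τ * Ψ c).bijective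
  · exact (τ * swap * Ψ c).bijective

/-! ### Direct automorphisms and the kernel of `ρ` -/

/-- The determinant of the action of an automorphism on the abelianization. -/
def detHom : MulAut F2 →* ℤˣ := Matrix.GeneralLinearGroup.det.comp ρ

theorem coe_detHom (x : MulAut F2) : (detHom x : ℤ) = (abMatrix x.toMonoidHom).det := rfl

theorem mem_AutPlus_iff_detHom (x : MulAut F2) : x ∈ AutPlus ↔ detHom x = 1 := by
  rw [mem_AutPlus_iff, IsDirect, ← coe_detHom]
  rcases Int.units_eq_one_or (detHom x) with h | h <;> rw [h] <;> decide

theorem ker_ρ_le_AutPlus : ρ.ker ≤ AutPlus := by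
  intro x hx
  rw [mem_AutPlus_iff_detHom, detHom, MonoidHom.comp_apply, (MonoidHom.mem_ker).1 hx, map_one]

theorem detHom_Ψ (c : B3) : detHom (Ψ c) = 1 := by
  have hc : c ∈ Subgroup.closure {B3.a, B3.b} := by rw [B3.closure_a_b]; trivial
  induction hc using Subgroup.closure_induction with
  | mem x hx =>
    rcases hx with rfl | rfl
    · apply Units.ext
      change (η B3.a : Matrix (Fin 2) (Fin 2) ℤ).det = 1
      rw [coe_η_a]
      simp
    · apply Units.ext
      change (η B3.b : Matrix (Fin 2) (Fin 2) ℤ).det = 1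
      rw [coe_η_b]
      simp
  | one => simp
  | mul x y _ _ hx hy => rw [map_mul, map_mul, hx, hy, one_mul]
  | inv x _ hx => rw [map_inv, map_inv, hx, inv_one]

theorem detHom_swap : detHom swap = -1 := by
  apply Units.ext
  rw [coe_detHom, Matrix.det_fin_two]
  simp [abMatrix, ab]

theorem innerBraid_le_AutPlus : innerBraid ≤ AutPlus := by
  apply sup_le (IntF2_le_ker_ρ.trans ker_ρ_le_AutPlus)
  rintro _ ⟨c, rfl⟩
  rw [mem_AutPlus_iff_detHom, detHom_Ψ]

theorem AutPlus_eq : AutPlus = innerBraid := by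
  refine le_antisymm (fun x hx => ?_) innerBraid_le_AutPlus
  obtain ⟨τ, hτ, c, h | h⟩ := exists_eq_of_tr_comm
    (tr_comm_of_surjective (φ := x.toMonoidHom) x.surjective)
  · have h' : x = τ * Ψ c := MulEquiv.ext fun w => DFunLike.congr_fun h w
    rw [h']
    exact mul_mem hτ (Ψ_mem_innerBraid c)
  · have h' : x = τ * swap * Ψ c := MulEquiv.ext fun w => DFunLike.congr_fun h w
    have hτ₁ := (mem_AutPlus_iff_detHom τ).1 (innerBraid_le_AutPlus hτ)
    rw [mem_AutPlus_iff_detHom, h', map_mul, map_mul, detHom_Ψ, detHom_swap, hτ₁] at hx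
    exact absurd hx (by decide)

theorem mem_AutPlus_iff_exists (x : MulAut F2) :
    x ∈ AutPlus ↔ ∃ h ∈ IntF2, ∃ c : B3, x = h * Ψ c := by
  rw [AutPlus_eq, mem_innerBraid]

/-- In a product `h * Ψ c` acting trivially on ℤ², the braid `c` lies in `ker η = Y`, so `Ψ c` is
inner too. -/
theorem IntF2_eq_ker_ρ : IntF2 = ρ.ker := by
  refine le_antisymm IntF2_le_ker_ρ fun x hx => ?_
  obtain ⟨h, hh, c, rfl⟩ := (mem_AutPlus_iff_exists x).1 (ker_ρ_le_AutPlus hx)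
  have hc : c ∈ B3.Y := by
    rw [← ker_η, MonoidHom.mem_ker, η, MonoidHom.comp_apply]
    rwa [MonoidHom.mem_ker, map_mul, (MonoidHom.mem_ker).1 (IntF2_le_ker_ρ hh), one_mul] at hx
  exact mul_mem hh (κ ⟨c, hc⟩).2

theorem isDirect_automorphism_iff (φ : F2 →* F2) :
    (Function.Bijective φ ∧ IsDirect φ) ↔
      ∃ w : F2, comm (φ t₁) (φ t₂) = w⁻¹ * comm t₁ t₂ * w := by
  constructor
  · rintro ⟨hφ, hd⟩
    have hx : MulEquiv.ofBijective φ hφ ∈ AutPlus := (mem_AutPlus_iff _).2 hd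
    obtain ⟨_, ⟨w, rfl⟩, c, hc⟩ := (mem_AutPlus_iff_exists _).1 hx
    refine ⟨w⁻¹, ?_⟩
    have := DFunLike.congr_fun hc (comm t₁ t₂)
    rw [MulAut.mul_apply, Ψ_comm, MulAut.conj_apply] at this
    rw [inv_inv, ← this, ← map_comm]
    rfl
  · rintro ⟨w, hw⟩
    -- Conjugating by `w` reduces to the case of a preserved commutator.
    obtain ⟨c, hc⟩ := (exists_Ψ_eq_iff ((MulAut.conj w).toMonoidHom.comp φ)).2 (by
      rw [← map_comm, MonoidHom.comp_apply, map_comm φ, hw]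
      simp [MulAut.conj_apply, mul_assoc])
    have hφ : φ = (MulAut.conj w⁻¹ * Ψ c).toMonoidHom := by
      refine MonoidHom.ext fun x => ?_
      have := DFunLike.congr_fun hc x
      change w * φ x * w⁻¹ = Ψ c x at this
      change φ x = w⁻¹ * Ψ c x * w⁻¹⁻¹
      rw [← this]
      group
    rw [hφ]
    refine ⟨(MulAut.conj w⁻¹ * Ψ c).bijective, (mem_AutPlus_iff _).1 ?_⟩
    rw [AutPlus_eq]
    exact mul_mem (conj_mem_innerBraid _) (Ψ_mem_innerBraid c)

/-! ### The amalgamated semidirect product -/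

/-- The homomorphism `(h, c) ↦ h * Ψ c` from the semidirect product to the direct automorphisms. -/
def fromSemidirect : IntF2 ⋊[ψ] B3 →* AutPlus where
  toFun p := ⟨p.left * Ψ p.right, (mem_AutPlus_iff_exists _).2 ⟨_, p.left.2, _, rfl⟩⟩
  map_one' := by ext1; simp
  map_mul' p q := by
    apply Subtype.ext
    change (p.left : MulAut F2) * (Ψ p.right * q.left * (Ψ p.right)⁻¹) * Ψ (p.right * q.right) =
      p.left * Ψ p.right * (q.left * Ψ q.right)
    rw [map_mul]
    group

theorem fromSemidirect_surjective : Function.Surjective fromSemidirect := by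
  rintro ⟨x, hx⟩
  obtain ⟨h, hh, c, rfl⟩ := (mem_AutPlus_iff_exists x).1 hx
  exact ⟨⟨⟨h, hh⟩, c⟩, rfl⟩

theorem ker_fromSemidirect : fromSemidirect.ker = (antidiag amalgamConditions).range := by
  ext ⟨h, c⟩
  rw [MonoidHom.mem_ker]
  constructor
  · intro hk
    have h₁ : (h : MulAut F2) * Ψ c = 1 := congrArg Subtype.val hk
    have h₂ : Ψ c = (h : MulAut F2)⁻¹ := eq_inv_of_mul_eq_one_right h₁
    have hc : c ∈ B3.Y := by
      rw [← ker_η, MonoidHom.mem_ker, η, MonoidHom.comp_apply, h₂, map_inv,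
        (MonoidHom.mem_ker).1 (IntF2_le_ker_ρ h.2), inv_one]
    refine ⟨⟨c, hc⟩, ?_⟩
    ext1
    · apply Subtype.ext
      change (Ψ c)⁻¹ = h
      rw [h₂, inv_inv]
    · rfl
  · rintro ⟨m, hm⟩
    rw [← hm]
    apply Subtype.ext
    change (Ψ (m : B3))⁻¹ * Ψ (m : B3) = 1
    exact inv_mul_cancel _

theorem exists_amalgamatedSemidirectProduct_equiv :
    ∃ e : AmalgamatedSemidirectProduct amalgamConditions ≃* AutPlus,
      ∀ (h : IntF2) (c : B3), (e (QuotientGroup.mk ⟨h, c⟩) : MulAut F2) = h * Ψ c :=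
  ⟨(QuotientGroup.quotientMulEquivOfEq ker_fromSemidirect.symm).trans
    (QuotientGroup.quotientKerEquivOfSurjective _ fromSemidirect_surjective), fun _ _ => rfl⟩

end Nielsen

theorem mainTheorem2 :
    -- (i)
    (∀ x : Nielsen.F2 →* Nielsen.F2, Function.Surjective x → Function.Bijective x) ∧
    -- (ii)
    (Function.Injective Nielsen.Ψ ∧
      Nielsen.Ψ (Nielsen.B3.s ^ 4) = MulAut.conj (Nielsen.comm Nielsen.t₁ Nielsen.t₂) ∧
      Subgroup.center Nielsen.B3 = Subgroup.zpowers (Nielsen.B3.s ^ 2) ∧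
      Nielsen.B3.Y ≤ Subgroup.center Nielsen.B3 ∧
      Nielsen.B3.Y.relIndex (Subgroup.center Nielsen.B3) = 2 ∧
      Nielsen.IntF2 ⊓ Nielsen.Ψ.range = Nielsen.B3.Y.map Nielsen.Ψ ∧
      (∀ x : MulAut Nielsen.F2, x ∈ Nielsen.AutPlus ↔
        ∃ h ∈ Nielsen.IntF2, ∃ c : Nielsen.B3, x = h * Nielsen.Ψ c) ∧
      ∃ e : Nielsen.AmalgamatedSemidirectProduct Nielsen.amalgamConditions ≃* Nielsen.AutPlus,
        ∀ (h : Nielsen.IntF2) (c : Nielsen.B3),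
          (e (QuotientGroup.mk ⟨h, c⟩) : MulAut Nielsen.F2) = h * Nielsen.Ψ c) ∧
    -- (iii)
    Nielsen.IntF2 = Nielsen.ρ.ker ∧
    -- (iv)
    (∀ φ : Nielsen.F2 →* Nielsen.F2,
      ((Function.Bijective φ ∧ Nielsen.IsDirect φ) ↔
        ∃ w : Nielsen.F2, Nielsen.comm (φ Nielsen.t₁) (φ Nielsen.t₂) =
          w⁻¹ * Nielsen.comm Nielsen.t₁ Nielsen.t₂ * w) ∧
      ((∃ c : Nielsen.B3, φ = (Nielsen.Ψ c).toMonoidHom) ↔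
        Nielsen.comm (φ Nielsen.t₁) (φ Nielsen.t₂) = Nielsen.comm Nielsen.t₁ Nielsen.t₂)) :=
  ⟨fun _ => Nielsen.bijective_of_surjective,
    ⟨Nielsen.Ψ_injective, Nielsen.Ψ_s_pow_four, Nielsen.center_B3, Nielsen.B3.Y_le_center,
      Nielsen.relIndex_Y, Nielsen.IntF2_inf_range_Ψ, Nielsen.mem_AutPlus_iff_exists,
      Nielsen.exists_amalgamatedSemidirectProduct_equiv⟩,
    Nielsen.IntF2_eq_ker_ρ,
    fun φ => ⟨Nielsen.isDirect_automorphism_iff φ, Nielsen.exists_Ψ_eq_iff φ⟩⟩
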